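/- Let $A\in\mathbb R^{n\times n}$, $B\in\mathbb R^{n\times m}$, and let $Q\in\mathbb R^{n\times n}$, $R\in\mathbb R^{m\times m}$, $\Sigma_w\in\mathbb R^{n\times n}$ be symmetric with $\beta_0 I\preceq Q\preceq\beta_1 I$, $\beta_0 I\preceq R\preceq\beta_1 I$, $\Sigma_w\succeq\sigma_w^2 I$, where $0<\beta_0$, $\beta_1\le 1$, $\sigma_w>0$. Call $K\in\mathbb R^{m\times n}$ stabilizing if all eigenvalues of $A+BK$ have modulus $<1$; for such $K$ let $\Sigma_K\succ0$ be the solution of $\Sigma_K=\Sigma_w+(A+BK)\Sigma_K(A+BK)^\top$ and let $J(K)=\operatorname{trace}\big((Q+K^\top RK)\Sigma_K\big)$ be the LQR cost of the policy $u_t=Kx_t$ for $x_{t+1}=Ax_t+Bu_t+w_t$ with noise covariance $\Sigma_w$. Let $J^\star=\inf J(K)$ over stabilizing $K$. Let $\psi\ge1$ with $\|B\|\le\psi$ (spectral norm), let $\bar J>0$ with $J^\star\le\bar J/4$, and put $\mathcal K=\{K \text{ stabilizing}: J(K)\le\bar J\}$. Below, $\nabla J$ is the gradient and $\|\cdot\|$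 the norm for the Frobenius inner product on $\mathbb R^{m\times n}$. Set $$\zeta=\sqrt{\tfrac{\bar J}{\beta_0\sigma_w^2}},\quad \mu=\frac{2\bar J}{\zeta^4},\quad L=\frac{112\sqrt n\,\bar J\psi^2\zeta^8}{\beta_0},\quad G=\frac{2\bar J}{\beta_0\sigma_w^2}\sqrt{(\sigma_w^2+\psi^2\bar J)\bar J},\quad D=\frac1{\psi\zeta^3}.$$ Let $T\ge1$, $0<\eta<\min\{D/G,\,1/(4L)\}$, $\gamma=\sqrt{1-\mu\eta}$ and $K_0\in\mathcal K$. Let $n_0,n_1,\dots$ be independent random matrices in $\mathbb R^{m\times n}$ with $\mathbb E[n_t]=0$, $\mathbb E\|n_t\|^2=\sigma_N^2$ for all $t$, and $\|n_t\|\le\Delta$ almost surely for $0\le t\le T-1$. Let $$\sigma_{lb}^2=G^2\Delta^2\max\Big\{\frac{\eta^2}{(D-G\eta)^2},\frac{2}{\mu\bar J}\Big\},\qquad \bar\sigma_p>0,\qquad \bar\sigma_p^2\ge\sigma_{lb}^2 .$$ Define the power allocation $\sigma_0,\dots,\sigma_{T-1}\ge0$ (CtG) by $$t_s=\min\Big\{0\le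 t\le T-1:\ \gamma^{T-1-t}\ge\frac{1-\gamma^{T-t}}{1-\gamma}\cdot\frac{\sigma_{lb}^2}{T\bar\sigma_p^2-t\sigma_{lb}^2}\Big\},$$ $\sigma_t^2=\sigma_{lb}^2$ for $t<t_s$, and $\sigma_t^2=\dfrac{\gamma^{T-1-t}}{\sum_{\ell=t_s}^{T-1}\gamma^{T-\ell-1}}\,(T\bar\sigma_p^2-t_s\sigma_{lb}^2)$ for $t_s\le t\le T-1$. Run policy gradient over the noisy channel, $$K_{t+1}=K_t-\eta\,\frac{G}{\sigma_t}\Big(\sigma_t\frac{\nabla J(K_t)}{G}+n_t\Big),\qquad 0\le t\le T-1 .$$ Then almost surely $K_t\in\mathcal K$ for all $0\le t\le T$, the random variable $J(K_T)$ is integrable, and $$\mathbb E[J(K_T)-J^\star]\le(1-\mu\eta)^T\,(J(K_0)-J^\star)+LG^2\eta^2\sigma_N^2\left(\frac{\sum_{t=0}^{t_s-1}\gamma^{2(T-t-1)}}{\sigma_{lb}^2}+\frac{\Big(\sum_{t=t_s}^{T-1}\gamma^{T-t-1}\Big)^2}{T\bar\sigma_p^2-t_s\sigma_{lb}^2}\right),$$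 where the first fraction is $0$ when $t_s=0$. -/

import Mathlib

open MeasureTheory ProbabilityTheory

noncomputable section

namespace LQRPower

/-- Feedback gains `K ∈ ℝ^{m × n}` with the Frobenius inner product and Frobenius norm,
realized as the Euclidean space over the index set of the matrix entries. -/
abbrev Gain (m n : ℕ) : Type := EuclideanSpace ℝ (Fin m × Fin n)

/-- A gain, read as an `m × n` matrix. -/
def Gain.toMat {m n : ℕ} (K : Gain m n) : Matrix (Fin m) (Fin n) ℝ :=
  Matrix.of fun i j => K (i, j)

open scoped Matrix.Norms.L2Operator in
/-- Spectral norm (largest singular value) of a real matrix. -/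
def spectralNorm {k l : ℕ} (M : Matrix (Fin k) (Fin l) ℝ) : ℝ := ‖M‖

/-- All complex eigenvalues of the real matrix `M` lie in the open unit disc. -/
def IsSchurStable {n : ℕ} (M : Matrix (Fin n) (Fin n) ℝ) : Prop :=
  ∀ z ∈ spectrum ℂ (M.map ((↑) : ℝ → ℂ)), ‖z‖ < 1

open Classical in
/-- The positive definite solution `S` of `S = W + M S Mᵀ` (zero if there is none).
If `W` is positive definite and `M` is Schur stable, it exists and is unique. -/
def lyapunovSolution {n : ℕ} (M W : Matrix (Fin n) (Fin n) ℝ) : Matrix (Fin n) (Fin n) ℝ :=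
  if h : ∃ S : Matrix (Fin n) (Fin n) ℝ, S.PosDef ∧ S = W + M * S * M.transpose then h.choose
  else 0

/-- Data of an LQR problem: `x_{t+1} = A x_t + B u_t + w_t`, where `W` is the covariance of `w_t`,
with stage cost `xᵀ Q x + uᵀ R u`. -/
structure LQR (n m : ℕ) where
  A : Matrix (Fin n) (Fin n) ℝ
  B : Matrix (Fin n) (Fin m) ℝ
  Q : Matrix (Fin n) (Fin n) ℝ
  R : Matrix (Fin m) (Fin m) ℝ
  W : Matrix (Fin n) (Fin n) ℝ

namespace LQR

variable {n m : ℕ}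

/-- Closed-loop matrix `A + B K`. -/
def closedLoop (S : LQR n m) (K : Gain m n) : Matrix (Fin n) (Fin n) ℝ := S.A + S.B * K.toMat

/-- `K` is stabilizing. -/
def Stabilizing (S : LQR n m) (K : Gain m n) : Prop := IsSchurStable (S.closedLoop K)

/-- Stationary state covariance `Σ_K` under `u_t = K x_t`. -/
def stateCov (S : LQR n m) (K : Gain m n) : Matrix (Fin n) (Fin n) ℝ :=
  lyapunovSolution (S.closedLoop K) S.W

/-- `J(K) = trace ((Q + Kᵀ R K) Σ_K)`. It is meaningful for stabilizing `K` (for the others the cost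
is infinite); stability is required separately wherever the cost is used. -/
def cost (S : LQR n m) (K : Gain m n) : ℝ :=
  ((S.Q + K.toMat.transpose * S.R * K.toMat) * S.stateCov K).trace

/-- Optimal value `J⋆`: the infimum of `J` over the stabilizing gains. -/
def optCost (S : LQR n m) : ℝ := sInf (S.cost '' {K | S.Stabilizing K})

/-- The feasible set `{K : J(K) ≤ Jbar}`. -/
def feasible (S : LQR n m) (Jbar : ℝ) : Set (Gain m n) :=
  {K | S.Stabilizing K ∧ S.cost K ≤ Jbar}

end LQR

section Allocation

/-- `γ = √(1 - μ η)`. -/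
def gam (μ η : ℝ) : ℝ := √(1 - μ * η)

/-- The switching time of the `CtG` allocation; `pSq` is the average power budget and `lbSq`
the lower bound on the power. -/
def ctgSwitch (T : ℕ) (pSq μ η lbSq : ℝ) : ℕ :=
  sInf {t : ℕ | t < T ∧
    gam μ η ^ (T - 1 - t) ≥
      (1 - gam μ η ^ (T - t)) / (1 - gam μ η) * (lbSq / (T * pSq - t * lbSq))}

/-- The power `σ_t²` that the `CtG` allocation assigns to time `t < T`. -/
def ctgPowerSq (T : ℕ) (pSq μ η lbSq : ℝ) (t : ℕ) : ℝ :=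
  if t < ctgSwitch T pSq μ η lbSq then lbSq
  else gam μ η ^ (T - 1 - t) /
      (∑ l ∈ Finset.Ico (ctgSwitch T pSq μ η lbSq) T, gam μ η ^ (T - l - 1)) *
    (T * pSq - ctgSwitch T pSq μ η lbSq * lbSq)

/-- The amplitudes `σ_t` of the `CtG` allocation. -/
def ctg (T : ℕ) (pSq μ η lbSq : ℝ) (t : ℕ) : ℝ := √(ctgPowerSq T pSq μ η lbSq t)

end Allocation

section Descent

variable {E : Type*} [NormedAddCommGroup E] [InnerProductSpace ℝ E] [CompleteSpace E]

/-- Transmitted signal for the gradient `g` with amplitude `s`. -/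
def enc (G s : ℝ) (g : E) : E := s • (G⁻¹ • g)

/-- Decoded value of the received signal `y`. -/
def dec (G s : ℝ) (y : E) : E := (G / s) • y

/-- Power-allocated gradient descent on `f` with step size `η`, gradient normalization `G`,
amplitudes `s`, initial point `x₀` and channel noise `ν`. -/
def pagd (f : E → ℝ) (G η : ℝ) (s : ℕ → ℝ) (x₀ : E) (ν : ℕ → E) : ℕ → E
  | 0 => x₀
  | t + 1 => pagd f G η s x₀ ν t -
      η • dec G (s t) (enc G (s t) (gradient f (pagd f G η s x₀ ν t)) + ν t)

end Descent

end LQRPower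

end

/-!
With `ζ² = J̄ / (β₀ σ_w²)`, every `K` in the feasible set has `σ_w² I ≤ Σ_K ≤ σ_w² ζ² I` in the
Loewner order, so the closed loop `M` satisfies `M Σ_K Mᵀ = Σ_K - Σ_w ≤ (1 - ζ⁻²) Σ_K`. Since
`M Z Mᵀ ≤ Z` forces `Z ≥ 0` for a stable `M`, this contraction controls every perturbation: after a
small change of gain, `Σ_K` is still contracted, so the new gain is stabilizing, and its covariance
differs from `Σ_K` by a small multiple of `Σ_K`.

Expanding the one-step Bellman cost at `K` and tracing against `Σ_{K'}` gives an exact formula for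
`J(K') - J(K)`. Completing the square in it yields gradient domination,
`2 μ (J - J⋆) ≤ ‖∇J‖²`; comparing `Σ_{K'}` with `Σ_K` yields `∇J = 2 E_K Σ_K` and a quadratic upper
bound for `J(K') - J(K) - ⟪∇J(K), K' - K⟫`.

The decoded noise acts as an additive gradient error `e = (G / σ_t) n_t`, and `σ_t ≥ σ_lb` makes
`‖e‖² ≤ μ J̄ / 2`. An inexact gradient step then maps the feasible set into itself: it contracts
`J - J⋆` by `1 - μ η` up to an error of at most `μ η J̄ / 4`, and `J⋆ ≤ J̄ / 4`. In expectation the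
cross term `⟪∇J(K_t), n_t⟫` vanishes because `n_t` is centered and independent of `K_t`. This leaves
an affine recursion whose forcing term is `L η² G² σ_N² / σ_t²`, and inserting the `CtG` powers
gives the stated sum.
-/

namespace LQRPower

open Matrix Filter Topology
open scoped MatrixOrder

section LoewnerOrder

variable {ι κ : Type*}

theorem transpose_eq_of_nonneg {S : Matrix ι ι ℝ} (hS : 0 ≤ S) : Sᵀ = S := by
  simpa [IsHermitian, conjTranspose_eq_transpose_of_trivial] using hS.posSemidef.isHermitian

theorem quadForm_nonneg [Fintype ι] {S : Matrix ι ι ℝ} (hS : 0 ≤ S) (x : ι → ℝ) :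
    0 ≤ x ⬝ᵥ S *ᵥ x := by
  simpa using hS.posSemidef.dotProduct_mulVec_nonneg x

theorem nonneg_of_quadForm_nonneg [Fintype ι] {S : Matrix ι ι ℝ} (hS : Sᵀ = S)
    (h : ∀ x, 0 ≤ x ⬝ᵥ S *ᵥ x) : 0 ≤ S :=
  nonneg_iff_posSemidef.2 <| .of_dotProduct_mulVec_nonneg
    (by rw [IsHermitian, conjTranspose_eq_transpose_of_trivial, hS]) (by simpa using h)

theorem isClosed_nonneg [Finite ι] : IsClosed {S : Matrix ι ι ℝ | 0 ≤ S} := by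
  have := Fintype.ofFinite ι
  have h_iff : {S : Matrix ι ι ℝ | 0 ≤ S} =
      {S | Sᵀ = S} ∩ ⋂ x : ι → ℝ, {S | 0 ≤ x ⬝ᵥ S *ᵥ x} := by
    ext S
    simp only [Set.mem_inter_iff, Set.mem_iInter, Set.mem_ofPred_eq]
    exact ⟨fun h => ⟨transpose_eq_of_nonneg h, quadForm_nonneg h⟩,
      fun h => nonneg_of_quadForm_nonneg h.1 h.2⟩
  rw [h_iff]
  exact (isClosed_eq (by fun_prop) continuous_id).inter
    (isClosed_iInter fun x => isClosed_le continuous_const (by fun_prop))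

variable [Fintype ι] [Finite κ]

theorem mul_mul_transpose_nonneg {S : Matrix ι ι ℝ} (hS : 0 ≤ S) (A : Matrix κ ι ℝ) :
    0 ≤ A * S * Aᵀ := by
  simpa using (hS.posSemidef.mul_mul_conjTranspose_same A).nonneg

theorem transpose_mul_mul_nonneg {S : Matrix ι ι ℝ} (hS : 0 ≤ S) (A : Matrix ι κ ℝ) :
    0 ≤ Aᵀ * S * A := by
  simpa using mul_mul_transpose_nonneg hS Aᵀ

theorem transpose_mul_self_nonneg (A : Matrix ι κ ℝ) : 0 ≤ Aᵀ * A := by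
  simpa using (posSemidef_conjTranspose_mul_self A).nonneg

theorem mul_mul_transpose_mono {X Y : Matrix ι ι ℝ} (h : X ≤ Y) (A : Matrix κ ι ℝ) :
    A * X * Aᵀ ≤ A * Y * Aᵀ := by
  rw [← sub_nonneg, ← Matrix.sub_mul, ← Matrix.mul_sub]
  exact mul_mul_transpose_nonneg (sub_nonneg.2 h) A

theorem transpose_mul_mul_mono {X Y : Matrix ι ι ℝ} (h : X ≤ Y) (A : Matrix ι κ ℝ) :
    Aᵀ * X * A ≤ Aᵀ * Y * A := by
  simpa using mul_mul_transpose_mono h Aᵀ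

/- Young's inequality: expand `0 ≤ a⁻¹ (a U - V) S (a U - V)ᵀ`. -/
theorem mul_mul_transpose_add_swap_le {S : Matrix ι ι ℝ} (hS : 0 ≤ S) (U V : Matrix κ ι ℝ) {a : ℝ}
    (ha : 0 < a) : U * S * Vᵀ + V * S * Uᵀ ≤ a • (U * S * Uᵀ) + a⁻¹ • (V * S * Vᵀ) := by
  have := Fintype.ofFinite κ
  rw [← sub_nonneg]
  convert smul_nonneg (inv_nonneg.2 ha.le) (mul_mul_transpose_nonneg hS (a • U - V)) using 1
  simp only [Matrix.sub_mul, Matrix.mul_sub, transpose_sub, transpose_smul, Matrix.smul_mul,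
    Matrix.mul_smul, smul_sub, smul_smul, inv_mul_cancel₀ ha.ne', one_smul]
  simp only [← mul_assoc, inv_mul_cancel₀ ha.ne', one_mul]
  abel

theorem neg_le_mul_mul_transpose_add_swap {S : Matrix ι ι ℝ} (hS : 0 ≤ S) (U V : Matrix κ ι ℝ)
    {a : ℝ} (ha : 0 < a) :
    -(a • (U * S * Uᵀ) + a⁻¹ • (V * S * Vᵀ)) ≤ U * S * Vᵀ + V * S * Uᵀ := by
  rw [neg_le]
  simpa [add_comm] using mul_mul_transpose_add_swap_le hS U (-V) ha

theorem exists_transpose_eq_mul_self_eq {S : Matrix ι ι ℝ} (hS : 0 ≤ S) :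
    ∃ C : Matrix ι ι ℝ, Cᵀ = C ∧ C * C = S := by
  classical
  exact ⟨CFC.sqrt S, transpose_eq_of_nonneg (CFC.sqrt_nonneg S), CFC.sqrt_mul_sqrt_self S⟩

theorem trace_mul_nonneg {X S : Matrix ι ι ℝ} (hX : 0 ≤ X) (hS : 0 ≤ S) : 0 ≤ (X * S).trace := by
  obtain ⟨C, hCT, rfl⟩ := exists_transpose_eq_mul_self_eq hS
  rw [← Matrix.mul_assoc, trace_mul_comm, ← Matrix.mul_assoc]
  nth_rw 2 [← hCT]
  exact (mul_mul_transpose_nonneg hX C).posSemidef.trace_nonneg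

theorem trace_mul_mono {X Y S : Matrix ι ι ℝ} (h : X ≤ Y) (hS : 0 ≤ S) :
    (X * S).trace ≤ (Y * S).trace := by
  have := trace_mul_nonneg (sub_nonneg.2 h) hS
  rwa [Matrix.sub_mul, trace_sub, sub_nonneg] at this

theorem trace_mono {X Y : Matrix ι ι ℝ} (h : X ≤ Y) : X.trace ≤ Y.trace := by
  classical
  simpa using trace_mul_mono h zero_le_one

/- Add `0 ≤ tr ((V - U) (δ S + X))` and `0 ≤ tr ((V + U) (δ S - X))`. -/
theorem trace_mul_le_of_abs_le {U V S X : Matrix ι ι ℝ} {δ : ℝ} (hUV : U ≤ V) (hVU : -V ≤ U)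
    (hXS : X ≤ δ • S) (hSX : -(δ • S) ≤ X) : (U * X).trace ≤ δ * (V * S).trace := by
  have h₁ := trace_mul_nonneg (sub_nonneg.2 hUV) (sub_nonneg.2 hSX)
  have h₂ := trace_mul_nonneg (sub_nonneg.2 hVU) (sub_nonneg.2 hXS)
  simp only [Matrix.sub_mul, Matrix.mul_sub, trace_sub, Matrix.mul_neg, Matrix.neg_mul, trace_neg,
    Matrix.mul_smul, trace_smul, smul_eq_mul] at h₁ h₂
  linarith

theorem abs_trace_mul_le_of_abs_le {U V S X : Matrix ι ι ℝ} {δ : ℝ} (hUV : U ≤ V) (hVU : -V ≤ U)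
    (hXS : X ≤ δ • S) (hSX : -(δ • S) ≤ X) : |(U * X).trace| ≤ δ * (V * S).trace := by
  refine abs_le'.2 ⟨trace_mul_le_of_abs_le hUV hVU hXS hSX, ?_⟩
  simpa using trace_mul_le_of_abs_le (neg_le.1 hVU) (neg_le_neg hUV) hXS hSX

variable [DecidableEq ι]

theorem vecMulVec_self_le (x : ι → ℝ) : vecMulVec x x ≤ (x ⬝ᵥ x) • (1 : Matrix ι ι ℝ) := by
  rw [← sub_nonneg]
  refine nonneg_of_quadForm_nonneg (by simp [transpose_vecMulVec]) fun y => ?_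
  have cauchy_schwarz : (x ⬝ᵥ y) ^ 2 ≤ (x ⬝ᵥ x) * (y ⬝ᵥ y) := by
    simpa [dotProduct, sq] using Finset.sum_mul_sq_le_sq_mul_sq Finset.univ x y
  simp only [sub_mulVec, vecMulVec_mulVec, dotProduct_sub, smul_mulVec, one_mulVec,
    dotProduct_smul, MulOpposite.smul_eq_mul_unop, MulOpposite.unop_op, smul_eq_mul,
    dotProduct_comm y x]
  linarith

theorem le_trace_smul_one {S : Matrix ι ι ℝ} (hS : 0 ≤ S) : S ≤ S.trace • 1 := by
  rw [← sub_nonneg]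
  refine nonneg_of_quadForm_nonneg (by simp [transpose_eq_of_nonneg hS]) fun x => ?_
  have := trace_mul_mono (vecMulVec_self_le x) hS
  simp only [vecMulVec_mul, trace_vecMulVec, smul_mul, one_mul, trace_smul, smul_eq_mul] at this
  simp only [sub_mulVec, smul_mulVec, one_mulVec, dotProduct_sub, dotProduct_smul, smul_eq_mul,
    dotProduct_mulVec, dotProduct_comm _ x] at this ⊢
  linarith

theorem mul_self_le_smul {S : Matrix ι ι ℝ} {c : ℝ} (hS : 0 ≤ S) (h : S ≤ c • 1) :
    S * S ≤ c • S := by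
  obtain ⟨C, hCT, rfl⟩ := exists_transpose_eq_mul_self_eq hS
  simpa [hCT, Matrix.mul_assoc] using mul_mul_transpose_mono h C

theorem sq_smul_one_le_mul_self {S : Matrix ι ι ℝ} {c : ℝ} (hc : 0 ≤ c) (h : c • 1 ≤ S) :
    c ^ 2 • 1 ≤ S * S := by
  have hS : 0 ≤ S := (smul_nonneg hc zero_le_one).trans h
  obtain ⟨C, hCT, rfl⟩ := exists_transpose_eq_mul_self_eq hS
  calc c ^ 2 • (1 : Matrix ι ι ℝ) = c • c • 1 := by rw [smul_smul, sq]
    _ ≤ c • (C * C) := by gcongr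
    _ ≤ C * C * (C * C) := by
      simpa [hCT, Matrix.mul_assoc] using mul_mul_transpose_mono h C

end LoewnerOrder

section Stability

theorem tendsto_pow_of_forall_spectrum_norm_lt_one {𝓐 : Type*} [NormedRing 𝓐] [NormedAlgebra ℂ 𝓐]
    [CompleteSpace 𝓐] {a : 𝓐} (h : ∀ z ∈ spectrum ℂ a, ‖z‖ < 1) :
    Tendsto (fun k : ℕ => a ^ k) atTop (𝓝 0) := by
  rcases subsingleton_or_nontrivial 𝓐 with _ | _
  · simp only [Subsingleton.elim _ (0 : 𝓐), tendsto_const_nhds_iff]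
  have h_radius : spectralRadius ℂ a < ((1 : NNReal) : ENNReal) :=
    spectrum.spectralRadius_lt_of_forall_lt a fun z hz => by exact_mod_cast h z hz
  obtain ⟨r, h_radius_lt, hr⟩ := exists_between h_radius
  lift r to NNReal using ne_top_of_lt hr
  refine squeeze_zero_norm' ?_
    (tendsto_pow_atTop_nhds_zero_of_lt_one r.2 (by exact_mod_cast hr))
  have gelfand := spectrum.pow_nnnorm_pow_one_div_tendsto_nhds_spectralRadius a
  filter_upwards [gelfand.eventually_lt_const h_radius_lt, eventually_gt_atTop 0] with k hk hk₀
  have h_pow := ENNReal.rpow_le_rpow hk.le (Nat.cast_nonneg k : (0 : ℝ) ≤ k)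
  rw [← ENNReal.rpow_mul, one_div, inv_mul_cancel₀ (by exact_mod_cast hk₀.ne'),
    ENNReal.rpow_one, ENNReal.rpow_natCast] at h_pow
  exact_mod_cast h_pow

theorem norm_lt_one_of_mem_spectrum_of_tendsto_pow {𝕜 𝓐 : Type*} [NormedField 𝕜] [NormedRing 𝓐]
    [NormedAlgebra 𝕜 𝓐] [CompleteSpace 𝓐] [NormOneClass 𝓐] {a : 𝓐}
    (h : Tendsto (fun k : ℕ => a ^ k) atTop (𝓝 0)) {z : 𝕜} (hz : z ∈ spectrum 𝕜 a) : ‖z‖ < 1 := by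
  by_contra! hz₁
  have one_le_norm_pow (k : ℕ) : 1 ≤ ‖a ^ k‖ :=
    calc 1 ≤ ‖z‖ ^ k := one_le_pow₀ hz₁
      _ = ‖z ^ k‖ := (norm_pow _ _).symm
      _ ≤ ‖a ^ k‖ := spectrum.norm_le_norm_of_mem (spectrum.pow_mem_pow a k hz)
  have := ge_of_tendsto' h.norm one_le_norm_pow
  norm_num at this

variable {ι : Type*} [Fintype ι] [DecidableEq ι] {M S W Z : Matrix ι ι ℝ}

theorem tendsto_map_ofReal_pow_iff :
    Tendsto (fun k : ℕ => M.map ((↑) : ℝ → ℂ) ^ k) atTop (𝓝 0) ↔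
      Tendsto (fun k : ℕ => M ^ k) atTop (𝓝 0) := by
  have map_pow (k : ℕ) : M.map ((↑) : ℝ → ℂ) ^ k = (M ^ k).map (↑) :=
    (Matrix.map_pow (f := Complex.ofRealHom) M k).symm
  simp only [map_pow]
  refine tendsto_pi_nhds.trans (.trans ?_ tendsto_pi_nhds.symm)
  refine forall_congr' fun i => tendsto_pi_nhds.trans (.trans ?_ tendsto_pi_nhds.symm)
  exact forall_congr' fun j => Filter.tendsto_ofReal_iff (x := 0)

open scoped Matrix.Norms.L2Operator in
theorem isSchurStable_iff_tendsto_pow {n : ℕ} {M : Matrix (Fin n) (Fin n) ℝ} :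
    IsSchurStable M ↔ Tendsto (fun k : ℕ => M ^ k) atTop (𝓝 0) := by
  refine ⟨fun h => tendsto_map_ofReal_pow_iff.1 (tendsto_pow_of_forall_spectrum_norm_lt_one h),
    fun h z hz => ?_⟩
  rcases isEmpty_or_nonempty (Fin n) with _ | _
  · rw [spectrum.of_subsingleton] at hz
    exact hz.elim
  · exact norm_lt_one_of_mem_spectrum_of_tendsto_pow (tendsto_map_ofReal_pow_iff.2 h) hz

theorem tendsto_pow_transpose (hM : Tendsto (fun k : ℕ => M ^ k) atTop (𝓝 0)) :
    Tendsto (fun k : ℕ => Mᵀ ^ k) atTop (𝓝 0) := by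
  have h_transpose : Continuous (transpose : Matrix ι ι ℝ → Matrix ι ι ℝ) := by fun_prop
  simpa [Function.comp_def, transpose_pow] using (h_transpose.tendsto 0).comp hM

theorem tendsto_pow_mul_mul_transpose_pow (hM : Tendsto (fun k : ℕ => M ^ k) atTop (𝓝 0))
    (Z : Matrix ι ι ℝ) : Tendsto (fun k : ℕ => M ^ k * Z * Mᵀ ^ k) atTop (𝓝 0) := by
  simpa using (hM.mul_const Z).mul (tendsto_pow_transpose hM)

theorem pow_mul_mul_transpose_pow_succ (M Z : Matrix ι ι ℝ) (k : ℕ) :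
    M ^ (k + 1) * Z * Mᵀ ^ (k + 1) = M * (M ^ k * Z * Mᵀ ^ k) * Mᵀ := by
  simp only [pow_succ' M, pow_succ Mᵀ, Matrix.mul_assoc]

theorem nonneg_of_mul_mul_transpose_le (hM : Tendsto (fun k : ℕ => M ^ k) atTop (𝓝 0))
    (h : M * Z * Mᵀ ≤ Z) : 0 ≤ Z := by
  have h_pow (k : ℕ) : M ^ k * Z * Mᵀ ^ k ≤ Z := by
    induction k with
    | zero => simp
    | succ k ih =>
      rw [pow_mul_mul_transpose_pow_succ]
      exact (mul_mul_transpose_mono ih M).trans h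
  have h_lim := (tendsto_pow_mul_mul_transpose_pow hM Z).const_sub Z
  simpa using isClosed_nonneg.mem_of_tendsto h_lim
    (.of_forall fun k => sub_nonneg.2 (h_pow k))

theorem eq_zero_of_eq_mul_mul_transpose (hM : Tendsto (fun k : ℕ => M ^ k) atTop (𝓝 0))
    (hZ : Z = M * Z * Mᵀ) : Z = 0 := by
  refine le_antisymm ?_ (nonneg_of_mul_mul_transpose_le hM hZ.ge)
  refine neg_nonneg.1 (nonneg_of_mul_mul_transpose_le hM ?_)
  rw [Matrix.mul_neg, Matrix.neg_mul, ← hZ]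

theorem exists_lyapunov (hM : Tendsto (fun k : ℕ => M ^ k) atTop (𝓝 0)) (W : Matrix ι ι ℝ) :
    ∃ S, S = W + M * S * Mᵀ := by
  let F : Matrix ι ι ℝ →ₗ[ℝ] Matrix ι ι ℝ :=
    { toFun := fun S => S - M * S * Mᵀ
      map_add' := fun S T => by simp only [Matrix.mul_add, Matrix.add_mul]; abel
      map_smul' := fun c S => by simp [smul_sub] }
  have hF : Function.Injective F := LinearMap.ker_eq_bot.1 <| LinearMap.ker_eq_bot'.2
    fun S hS => eq_zero_of_eq_mul_mul_transpose hM (sub_eq_zero.1 hS)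
  obtain ⟨S, hS⟩ := LinearMap.injective_iff_surjective.1 hF W
  exact ⟨S, sub_eq_iff_eq_add.1 hS⟩

theorem le_of_eq_lyapunov (hM : Tendsto (fun k : ℕ => M ^ k) atTop (𝓝 0)) (hW : 0 ≤ W)
    (hS : S = W + M * S * Mᵀ) : W ≤ S := by
  have h : M * S * Mᵀ ≤ S := by simpa [← hS] using add_le_add_left hW (M * S * Mᵀ)
  rw [hS, le_add_iff_nonneg_right]
  exact mul_mul_transpose_nonneg (nonneg_of_mul_mul_transpose_le hM h) M

theorem tendsto_pow_of_contraction {c q : ℝ} (hc : 0 < c) (hS : c • 1 ≤ S) (hq₀ : 0 ≤ q)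
    (hq : q < 1) (h : M * S * Mᵀ ≤ q • S) : Tendsto (fun k : ℕ => M ^ k) atTop (𝓝 0) := by
  have h_pow (k : ℕ) : M ^ k * S * Mᵀ ^ k ≤ q ^ k • S := by
    induction k with
    | zero => simp
    | succ k ih =>
      rw [pow_mul_mul_transpose_pow_succ, pow_succ, mul_smul]
      calc M * (M ^ k * S * Mᵀ ^ k) * Mᵀ ≤ M * (q ^ k • S) * Mᵀ := mul_mul_transpose_mono ih M
        _ = q ^ k • (M * S * Mᵀ) := by simp
        _ ≤ q ^ k • q • S := by gcongr
  have h_entry (k : ℕ) (i j : ι) : (M ^ k) i j ^ 2 ≤ q ^ k * (c⁻¹ * S.trace) := by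
    have h_trace : c * (M ^ k * Mᵀ ^ k).trace ≤ q ^ k * S.trace := by
      have := mul_mul_transpose_mono hS (M ^ k)
      rw [transpose_pow] at this
      simpa using trace_mono (this.trans (h_pow k))
    have h_sum : (M ^ k) i j ^ 2 ≤ (M ^ k * Mᵀ ^ k).trace := by
      simp only [← transpose_pow, trace, diag, mul_apply, transpose_apply, ← sq]
      exact (Finset.single_le_sum (f := fun j => (M ^ k) i j ^ 2) (fun _ _ => sq_nonneg _)
        (Finset.mem_univ j)).trans (Finset.single_le_sum
          (f := fun i => ∑ j, (M ^ k) i j ^ 2) (fun _ _ => by positivity) (Finset.mem_univ i))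
    rw [mul_left_comm, ← div_eq_inv_mul, le_div_iff₀' hc]
    exact (mul_le_mul_of_nonneg_left h_sum hc.le).trans h_trace
  have h_geom : Tendsto (fun k : ℕ => q ^ k * (c⁻¹ * S.trace)) atTop (𝓝 0) := by
    simpa using (tendsto_pow_atTop_nhds_zero_of_lt_one hq₀ hq).mul_const (c⁻¹ * S.trace)
  refine tendsto_pi_nhds.2 fun i => tendsto_pi_nhds.2 fun j => ?_
  refine (tendsto_zero_iff_abs_tendsto_zero _).2 ?_
  simpa [Real.sqrt_sq_eq_abs, Function.comp_def] using
    (squeeze_zero (fun k => sq_nonneg _) (fun k => h_entry k i j) h_geom).sqrt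

end Stability

section Lyapunov

variable {ι : Type*} {M S V W P : Matrix ι ι ℝ}

theorem posDef_of_smul_one_le [DecidableEq ι] {c : ℝ} (hc : 0 < c) (h : c • 1 ≤ W) : W.PosDef := by
  simpa using (PosDef.one.smul hc).add_posSemidef h

theorem lyapunovSolution_eq {n : ℕ} {M W : Matrix (Fin n) (Fin n) ℝ} (hM : IsSchurStable M)
    (hW : W.PosDef) : lyapunovSolution M W = W + M * lyapunovSolution M W * Mᵀ := by
  have h_exists : ∃ S : Matrix (Fin n) (Fin n) ℝ, S.PosDef ∧ S = W + M * S * Mᵀ := by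
    have hM_pow := isSchurStable_iff_tendsto_pow.1 hM
    obtain ⟨S, hS⟩ := exists_lyapunov hM_pow W
    have hWS := le_of_eq_lyapunov hM_pow hW.posSemidef.nonneg hS
    exact ⟨S, by simpa using hW.add_posSemidef hWS, hS⟩
  rw [lyapunovSolution, dif_pos h_exists]
  exact h_exists.choose_spec.2

theorem trace_mul_eq_trace_mul_of_lyapunov [Fintype ι] (hS : S = W + M * S * Mᵀ)
    (hP : P = V + Mᵀ * P * M) : (V * S).trace = (P * W).trace := by
  rw [eq_sub_of_add_eq hS.symm, eq_sub_of_add_eq hP.symm, Matrix.sub_mul, Matrix.mul_sub,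
    trace_sub, trace_sub]
  congr 1
  rw [Matrix.mul_assoc, Matrix.mul_assoc, trace_mul_comm Mᵀ]
  simp only [Matrix.mul_assoc]

end Lyapunov

section Gains

variable {m n : ℕ}

/-- An `m × n` matrix, read as a gain: the inverse of `Gain.toMat`. -/
def Gain.ofMat (X : Matrix (Fin m) (Fin n) ℝ) : Gain m n := WithLp.toLp 2 fun p => X p.1 p.2

theorem Gain.inner_eq_trace (K K' : Gain m n) :
    inner ℝ K K' = (K.toMatᵀ * K'.toMat).trace := by
  simp only [PiLp.inner_apply, Fintype.sum_prod_type, trace, diag, mul_apply, Gain.toMat,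
    transpose_apply, of_apply]
  rw [Finset.sum_comm]
  simp [mul_comm]

theorem Gain.norm_sq_eq_trace (K : Gain m n) : ‖K‖ ^ 2 = (K.toMatᵀ * K.toMat).trace := by
  rw [← Gain.inner_eq_trace, real_inner_self_eq_norm_sq]

theorem Gain.mul_transpose_self_le (K : Gain m n) : K.toMat * K.toMatᵀ ≤ ‖K‖ ^ 2 • 1 := by
  rw [K.norm_sq_eq_trace, trace_mul_comm]
  exact le_trace_smul_one (by simpa using transpose_mul_self_nonneg K.toMatᵀ)

end Gains

section SpectralNorm

variable {k l : ℕ} {X : Matrix (Fin k) (Fin l) ℝ} {c : ℝ}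

theorem spectralNorm_transpose (X : Matrix (Fin k) (Fin l) ℝ) :
    spectralNorm Xᵀ = spectralNorm X := by
  simpa [spectralNorm] using l2_opNorm_conjTranspose X

theorem transpose_mul_self_le_of_spectralNorm_le (h : spectralNorm X ≤ c) :
    Xᵀ * X ≤ c ^ 2 • 1 := by
  rw [← sub_nonneg]
  refine nonneg_of_quadForm_nonneg (by simp) fun x => ?_
  have h_mulVec : ‖WithLp.toLp 2 (X *ᵥ x)‖ ^ 2 ≤ (c * ‖WithLp.toLp 2 x‖) ^ 2 := by
    gcongr
    exact (l2_opNorm_mulVec X (WithLp.toLp 2 x)).trans (by gcongr; exact h)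
  simp only [mul_pow, EuclideanSpace.norm_sq_eq, Real.norm_eq_abs, sq_abs] at h_mulVec
  simp only [sub_mulVec, smul_mulVec, one_mulVec, dotProduct_sub, dotProduct_smul, smul_eq_mul,
    sub_nonneg, ← mulVec_mulVec, dotProduct_mulVec x, vecMul_transpose]
  simpa only [dotProduct, ← sq] using h_mulVec

theorem mul_transpose_self_le_of_spectralNorm_le (h : spectralNorm X ≤ c) :
    X * Xᵀ ≤ c ^ 2 • 1 := by
  rw [← spectralNorm_transpose] at h
  simpa using transpose_mul_self_le_of_spectralNorm_le h

end SpectralNorm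

section LyapunovPerturbation

variable {ι : Type*} [Fintype ι] {M M' N S S' W X F : Matrix ι ι ℝ} {c q ε : ℝ}

theorem mul_mul_transpose_le_of_lyapunov (hS : S = W + M * S * Mᵀ) (h : c • S ≤ W) :
    M * S * Mᵀ ≤ (1 - c) • S := by
  rw [eq_sub_of_add_eq' hS.symm, sub_smul, one_smul]
  gcongr

theorem add_mul_mul_transpose_sub (M N S : Matrix ι ι ℝ) :
    (M + N) * S * (M + N)ᵀ - M * S * Mᵀ = M * S * Nᵀ + N * S * Mᵀ + N * S * Nᵀ := by
  simp only [transpose_add, Matrix.add_mul, Matrix.mul_add]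
  abel

theorem young_bound_le (hM : M * S * Mᵀ ≤ S) (hN : N * S * Nᵀ ≤ ε ^ 2 • S)
    (hε : 0 < ε) : ε • (M * S * Mᵀ) + ε⁻¹ • (N * S * Nᵀ) ≤ (2 * ε) • S :=
  calc ε • (M * S * Mᵀ) + ε⁻¹ • (N * S * Nᵀ) ≤ ε • S + ε⁻¹ • (ε ^ 2 • S) := by gcongr
    _ = (2 * ε) • S := by rw [smul_smul, ← add_smul]; congr 1; field_simp; ring

theorem add_mul_mul_transpose_sub_le (hS : 0 ≤ S) (hM : M * S * Mᵀ ≤ S)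
    (hN : N * S * Nᵀ ≤ ε ^ 2 • S) (hε : 0 < ε) (hε₁ : ε ≤ 1) :
    (M + N) * S * (M + N)ᵀ - M * S * Mᵀ ≤ (3 * ε) • S := by
  have hε_sq : ε ^ 2 ≤ ε := pow_le_of_le_one hε.le hε₁ two_ne_zero
  rw [add_mul_mul_transpose_sub]
  calc _ ≤ (2 * ε) • S + ε ^ 2 • S := add_le_add
        ((mul_mul_transpose_add_swap_le hS M N hε).trans (young_bound_le hM hN hε)) hN
    _ ≤ (2 * ε) • S + ε • S := by gcongr
    _ = (3 * ε) • S := by rw [← add_smul]; ring_nf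

theorem neg_le_add_mul_mul_transpose_sub (hS : 0 ≤ S) (hM : M * S * Mᵀ ≤ S)
    (hN : N * S * Nᵀ ≤ ε ^ 2 • S) (hε : 0 < ε) :
    -((3 * ε) • S) ≤ (M + N) * S * (M + N)ᵀ - M * S * Mᵀ := by
  rw [add_mul_mul_transpose_sub]
  calc -((3 * ε) • S) ≤ -((2 * ε) • S) := by gcongr; norm_num
    _ ≤ -(ε • (M * S * Mᵀ) + ε⁻¹ • (N * S * Nᵀ)) := neg_le_neg (young_bound_le hM hN hε)
    _ ≤ M * S * Nᵀ + N * S * Mᵀ := neg_le_mul_mul_transpose_add_swap hS M N hε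
    _ ≤ _ := le_add_of_nonneg_right (mul_mul_transpose_nonneg hS N)

/- `Z = (c / q) S - X` satisfies `M Z Mᵀ ≤ Z`. -/
theorem le_of_lyapunov_of_contraction [DecidableEq ι]
    (hM : Tendsto (fun k : ℕ => M ^ k) atTop (𝓝 0)) (hX : X = F + M * X * Mᵀ)
    (hF : F ≤ c • S) (hc : 0 ≤ c) (hq : 0 < q) (hS : M * S * Mᵀ ≤ (1 - q) • S) :
    X ≤ (c / q) • S := by
  rw [← sub_nonneg]
  refine nonneg_of_mul_mul_transpose_le hM ?_
  rw [← sub_nonneg]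
  calc (0 : Matrix ι ι ℝ) ≤ (c / q) • ((1 - q) • S - M * S * Mᵀ) + (c • S - F) :=
        add_nonneg (smul_nonneg (by positivity) (sub_nonneg.2 hS)) (sub_nonneg.2 hF)
    _ = (c / q) • S - (F + M * X * Mᵀ) - M * ((c / q) • S - X) * Mᵀ := by
        simp only [Matrix.mul_sub, Matrix.sub_mul, Matrix.mul_smul, Matrix.smul_mul, smul_sub,
          sub_smul, one_smul, smul_smul, div_mul_cancel₀ c hq.ne']
        abel
    _ = _ := by rw [← hX]

theorem lyapunov_sub_eq (hS : S = W + M * S * Mᵀ) (hS' : S' = W + M' * S' * M'ᵀ) :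
    S' - S = M' * S * M'ᵀ - M * S * Mᵀ + M' * (S' - S) * M'ᵀ := by
  rw [Matrix.mul_sub, Matrix.sub_mul]
  nth_rw 1 [hS', hS]
  abel

end LyapunovPerturbation

section Allocation

variable {T t : ℕ} {pSq μ η lbSq γ : ℝ}

theorem remaining_budget_pos (ht : t < T) (hp : 0 < pSq) (hle : lbSq ≤ pSq) :
    0 < T * pSq - t * lbSq := by
  rw [sub_pos]
  calc (t : ℝ) * lbSq ≤ t * pSq := by gcongr
    _ < T * pSq := by gcongr

theorem ctgSwitch_spec (hT : 1 ≤ T) (hγ₁ : gam μ η < 1) (hp : 0 < pSq) (hle : lbSq ≤ pSq) :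
    ctgSwitch T pSq μ η lbSq < T ∧
      gam μ η ^ (T - 1 - ctgSwitch T pSq μ η lbSq) ≥
        (1 - gam μ η ^ (T - ctgSwitch T pSq μ η lbSq)) / (1 - gam μ η) *
          (lbSq / (T * pSq - ctgSwitch T pSq μ η lbSq * lbSq)) := by
  refine Nat.sInf_mem (s := {t : ℕ | t < T ∧ gam μ η ^ (T - 1 - t) ≥
      (1 - gam μ η ^ (T - t)) / (1 - gam μ η) * (lbSq / (T * pSq - t * lbSq))})
    ⟨T - 1, by omega, ?_⟩
  have h_last : T - (T - 1) = 1 := by omega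
  rw [h_last, pow_one, div_self (sub_pos.2 hγ₁).ne', one_mul, Nat.sub_self, pow_zero, ge_iff_le,
    div_le_one (remaining_budget_pos (by omega) hp hle), Nat.cast_sub hT, Nat.cast_one]
  have h_budget : (T : ℝ) * lbSq ≤ T * pSq := by gcongr
  linarith

theorem ctgSwitch_eq_zero (hT : 1 ≤ T) (hγ : 0 < gam μ η) : ctgSwitch T pSq μ η 0 = 0 := by
  refine Nat.sInf_eq_zero.2 (Or.inl ⟨by omega, ?_⟩)
  rw [zero_div, mul_zero]
  positivity

theorem sum_Ico_pow_sub (hγ : γ ≠ 1) (a : ℕ) :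
    ∑ l ∈ Finset.Ico a T, γ ^ (T - l - 1) = (1 - γ ^ (T - a)) / (1 - γ) := by
  have h_reindex : ∀ k ∈ Finset.range (T - a), γ ^ (T - (a + k) - 1) = γ ^ (T - a - 1 - k) :=
    fun k _ => by congr 1; omega
  rw [Finset.sum_Ico_eq_sum_range, Finset.sum_congr rfl h_reindex,
    Finset.sum_range_reflect (fun k => γ ^ k) (T - a), geom_sum_eq hγ, ← neg_div_neg_eq, neg_sub,
    neg_sub]

theorem sum_Ico_pow_sub_pos (hγ : 0 < γ) (ht : t < T) :
    0 < ∑ l ∈ Finset.Ico t T, γ ^ (T - l - 1) :=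
  Finset.sum_pos (fun _ _ => pow_pos hγ _) (Finset.nonempty_Ico.2 ht)

theorem ctgPowerSq_pos (hT : 1 ≤ T) (hγ : 0 < gam μ η) (hγ₁ : gam μ η < 1) (hp : 0 < pSq)
    (hle : lbSq ≤ pSq) (hlb : 0 ≤ lbSq) (t : ℕ) : 0 < ctgPowerSq T pSq μ η lbSq t := by
  have h_switch := (ctgSwitch_spec hT hγ₁ hp hle).1
  rw [ctgPowerSq]
  split_ifs with h
  · refine hlb.lt_of_ne ?_
    rintro rfl
    simp [ctgSwitch_eq_zero hT hγ] at h
  · exact mul_pos (div_pos (pow_pos hγ _) (sum_Ico_pow_sub_pos hγ h_switch))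
      (remaining_budget_pos h_switch hp hle)

theorem le_ctgPowerSq (hT : 1 ≤ T) (hγ : 0 < gam μ η) (hγ₁ : gam μ η < 1) (hp : 0 < pSq)
    (hle : lbSq ≤ pSq) (t : ℕ) : lbSq ≤ ctgPowerSq T pSq μ η lbSq t := by
  obtain ⟨h_switch, h_spec⟩ := ctgSwitch_spec hT hγ₁ hp hle
  rw [ctgPowerSq]
  split_ifs with h
  · exact le_rfl
  · have h_budget := remaining_budget_pos h_switch hp hle
    have h_mono : gam μ η ^ (T - 1 - ctgSwitch T pSq μ η lbSq) ≤ gam μ η ^ (T - 1 - t) :=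
      pow_le_pow_of_le_one hγ.le hγ₁.le (by omega)
    rw [ge_iff_le, ← sum_Ico_pow_sub hγ₁.ne, ← mul_div_assoc, div_le_iff₀ h_budget] at h_spec
    rw [div_mul_eq_mul_div, le_div_iff₀ (sum_Ico_pow_sub_pos hγ h_switch), mul_comm]
    exact h_spec.trans (by gcongr)

theorem ctg_sq (hT : 1 ≤ T) (hγ : 0 < gam μ η) (hγ₁ : gam μ η < 1) (hp : 0 < pSq)
    (hle : lbSq ≤ pSq) (hlb : 0 ≤ lbSq) (t : ℕ) :
    ctg T pSq μ η lbSq t ^ 2 = ctgPowerSq T pSq μ η lbSq t :=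
  Real.sq_sqrt (ctgPowerSq_pos hT hγ hγ₁ hp hle hlb t).le

theorem sum_gam_pow_div_ctgPowerSq (hT : 1 ≤ T) (hγ : 0 < gam μ η) (hγ₁ : gam μ η < 1)
    (hp : 0 < pSq) (hle : lbSq ≤ pSq) :
    ∑ t ∈ Finset.range T, gam μ η ^ (2 * (T - t - 1)) / ctgPowerSq T pSq μ η lbSq t =
      (∑ t ∈ Finset.range (ctgSwitch T pSq μ η lbSq), gam μ η ^ (2 * (T - t - 1))) / lbSq +
        (∑ t ∈ Finset.Ico (ctgSwitch T pSq μ η lbSq) T, gam μ η ^ (T - t - 1)) ^ 2 /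
          (T * pSq - ctgSwitch T pSq μ η lbSq * lbSq) := by
  have h_switch := (ctgSwitch_spec hT hγ₁ hp hle).1
  have h_budget := remaining_budget_pos h_switch hp hle
  have := sum_Ico_pow_sub_pos hγ h_switch
  rw [← Finset.sum_range_add_sum_Ico _ h_switch.le, Finset.sum_div]
  congr 1
  · exact Finset.sum_congr rfl fun t ht => by rw [ctgPowerSq, if_pos (Finset.mem_range.1 ht)]
  · rw [sq, mul_div_assoc, Finset.sum_mul]
    refine Finset.sum_congr rfl fun t ht => ?_
    rw [ctgPowerSq, if_neg (Finset.mem_Ico.1 ht).1.not_gt, Nat.sub_right_comm T 1 t, two_mul,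
      pow_add]
    field_simp

end Allocation

section InexactStep

variable {E : Type*} [NormedAddCommGroup E] [InnerProductSpace ℝ E] {a b c L μ η : ℝ} {g e : E}

theorem inexact_step_le (hη : 0 ≤ η) (hLη : 2 * L * η ≤ 1)
    (h : b ≤ a - η * inner ℝ g (g + e) + L * η ^ 2 * ‖g + e‖ ^ 2) :
    b ≤ a - η / 2 * ‖g‖ ^ 2 + η / 2 * ‖e‖ ^ 2 := by
  have h_polarization : inner ℝ g (g + e) = (‖g‖ ^ 2 + ‖g + e‖ ^ 2 - ‖e‖ ^ 2) / 2 := by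
    rw [norm_add_sq_real, inner_add_right, real_inner_self_eq_norm_sq]
    ring
  have h_slack : 0 ≤ η / 2 * (1 - 2 * L * η) * ‖g + e‖ ^ 2 := by
    have := sub_nonneg.2 hLη
    positivity
  rw [h_polarization] at h
  linarith

theorem inexact_step_contraction (hη : 0 ≤ η) (hLη : 2 * L * η ≤ 1)
    (hμ : 2 * μ * (a - c) ≤ ‖g‖ ^ 2)
    (h : b ≤ a - η * inner ℝ g (g + e) + L * η ^ 2 * ‖g + e‖ ^ 2) :
    b - c ≤ (1 - μ * η) * (a - c) - η * (1 - 2 * L * η) * inner ℝ g e + L * η ^ 2 * ‖e‖ ^ 2 := by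
  have h_slack : 0 ≤ η / 2 * (1 - 2 * L * η) * ‖g‖ ^ 2 := by
    have := sub_nonneg.2 hLη
    positivity
  have h_dom : η / 2 * (2 * μ * (a - c)) ≤ η / 2 * ‖g‖ ^ 2 := by gcongr
  rw [norm_add_sq_real, inner_add_right, real_inner_self_eq_norm_sq] at h
  linarith

end InexactStep

theorem le_of_affine_recursion {a b : ℕ → ℝ} {q : ℝ} (hq : 0 ≤ q) {T : ℕ}
    (h : ∀ t < T, a (t + 1) ≤ q * a t + b t) :
    a T ≤ q ^ T * a 0 + ∑ t ∈ Finset.range T, q ^ (T - t - 1) * b t := by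
  induction T with
  | zero => simp
  | succ T ih =>
    have h_sum : ∑ t ∈ Finset.range T, q ^ (T + 1 - t - 1) * b t =
        q * ∑ t ∈ Finset.range T, q ^ (T - t - 1) * b t := by
      rw [Finset.mul_sum]
      refine Finset.sum_congr rfl fun t ht => ?_
      have h_exp : T + 1 - t - 1 = T - t - 1 + 1 := by
        have := Finset.mem_range.1 ht
        omega
      rw [h_exp, pow_succ', mul_assoc]
    rw [Finset.sum_range_succ, h_sum, Nat.add_sub_cancel_left, Nat.sub_self, pow_zero, one_mul]
    calc a (T + 1) ≤ q * a T + b T := h T T.lt_succ_self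
      _ ≤ q * (q ^ T * a 0 + ∑ t ∈ Finset.range T, q ^ (T - t - 1) * b t) + b T := by
          gcongr
          exact ih fun t ht => h t (ht.trans T.lt_succ_self)
      _ = _ := by ring

theorem integrable_comp_of_ae_mem {E Ω : Type*} [NormedAddCommGroup E] [NormedSpace ℝ E]
    [MeasurableSpace E] [BorelSpace E] [MeasurableSpace Ω] {P : Measure Ω} [IsFiniteMeasure P]
    {f : E → ℝ} {F : Set E} {X : Ω → E} (hX : Measurable X)
    (hXF : ∀ᵐ ω ∂P, X ω ∈ F) (hf : ∀ x ∈ F, DifferentiableAt ℝ f x)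
    (hC : ∃ C, ∀ x ∈ F, |f x| ≤ C) : Integrable (fun ω => f (X ω)) P := by
  classical
  obtain ⟨C, hC⟩ := hC
  have h_meas : Measurable ({x | DifferentiableAt ℝ f x}.piecewise f 0) :=
    ContinuousOn.measurable_piecewise
      (fun x hx => (DifferentiableAt.continuousAt hx).continuousWithinAt) continuousOn_const
      (measurableSet_of_differentiableAt ℝ f)
  have h_ae : ∀ᵐ ω ∂P, {x | DifferentiableAt ℝ f x}.piecewise f 0 (X ω) = f (X ω) := by
    filter_upwards [hXF] with ω hω using Set.piecewise_eq_of_mem _ _ _ (hf _ hω)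
  refine .of_bound ((h_meas.comp hX).aestronglyMeasurable.congr h_ae) C ?_
  filter_upwards [hXF] with ω hω using hC _ hω

section Noise

variable {E Ω : Type*} [NormedAddCommGroup E] [MeasurableSpace Ω] {P : Measure Ω}

/-- Independent, centered noise with common second moment `v`, bounded by `Δ`, up to time `T`. -/
structure IsBoundedNoise [NormedSpace ℝ E] [MeasurableSpace E] (ν : ℕ → Ω → E) (P : Measure Ω)
    (T : ℕ) (Δ v : ℝ) : Prop where
  measurable : ∀ t, Measurable (ν t)
  indep : iIndepFun ν P
  mean : ∀ t < T, ∫ ω, ν t ω ∂P = 0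
  sq_mean : ∀ t < T, ∫ ω, ‖ν t ω‖ ^ 2 ∂P = v
  norm_le : ∀ t < T, ∀ᵐ ω ∂P, ‖ν t ω‖ ≤ Δ

theorem integral_le_of_step_le [InnerProductSpace ℝ E] [CompleteSpace E] [MeasurableSpace E]
    [BorelSpace E] [IsFiniteMeasure P] {X Y : Ω → ℝ} {V N : Ω → E} {Δ a b q : ℝ}
    (hX : Integrable X P) (hY : Integrable Y P) (hV : Integrable V P)
    (hVN : IndepFun V N P) (hN : AEStronglyMeasurable N P) (hΔ : ∀ᵐ ω ∂P, ‖N ω‖ ≤ Δ)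
    (hmean : ∫ ω, N ω ∂P = 0)
    (hstep : ∀ᵐ ω ∂P, Y ω ≤ q * X ω - a * inner ℝ (V ω) (N ω) + b * ‖N ω‖ ^ 2) :
    ∫ ω, Y ω ∂P ≤ q * ∫ ω, X ω ∂P + b * ∫ ω, ‖N ω‖ ^ 2 ∂P := by
  have hN_int : Integrable N P := .of_bound hN Δ hΔ
  have h_inner : Integrable (fun ω => inner ℝ (V ω) (N ω)) P :=
    hVN.integrable_bilin hV hN_int (innerSL ℝ)
  have h_inner_zero : ∫ ω, inner ℝ (V ω) (N ω) ∂P = 0 :=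
    (hVN.integral_bilin hV hN_int (innerSL ℝ)).trans (by rw [hmean, map_zero])
  have h_sq : Integrable (fun ω => ‖N ω‖ ^ 2) P := by
    refine .of_bound (hN.norm.pow 2) (Δ ^ 2) ?_
    filter_upwards [hΔ] with ω hω
    rw [norm_pow, norm_norm]
    gcongr
  have h_drift : Integrable (fun ω => q * X ω - a * inner ℝ (V ω) (N ω)) P :=
    (hX.const_mul q).sub (h_inner.const_mul a)
  calc ∫ ω, Y ω ∂P ≤ ∫ ω, (q * X ω - a * inner ℝ (V ω) (N ω) + b * ‖N ω‖ ^ 2) ∂P :=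
        integral_mono_ae hY (h_drift.add (h_sq.const_mul b)) hstep
    _ = q * ∫ ω, X ω ∂P + b * ∫ ω, ‖N ω‖ ^ 2 ∂P := by
        rw [integral_add h_drift (h_sq.const_mul b), integral_sub (hX.const_mul q)
          (h_inner.const_mul a), integral_const_mul, integral_const_mul, integral_const_mul,
          h_inner_zero, mul_zero, sub_zero]

end Noise

section NoisyDescent

variable {E : Type*} [NormedAddCommGroup E] [InnerProductSpace ℝ E] [CompleteSpace E]
  {f : E → ℝ} {F : Set E} {G η L μ ε fopt v Δ : ℝ} {s : ℕ → ℝ} {x₀ : E} {T t : ℕ}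

/-- A set `F` preserved by gradient steps of size `η` whose error `e` satisfies `‖e‖² ≤ ε`, on
which `f` and its gradient are bounded, `f` is gradient dominated (Polyak–Łojasiewicz, with
constant `μ` relative to the value `fopt`), and along such steps `f` lies below the quadratic model
with curvature `2 L`. -/
structure IsDescentRegion (f : E → ℝ) (F : Set E) (fopt μ L η ε : ℝ) : Prop where
  differentiableAt : ∀ x ∈ F, DifferentiableAt ℝ f x
  abs_bdd : ∃ C, ∀ x ∈ F, |f x| ≤ C
  gradient_bdd : ∃ C, ∀ x ∈ F, ‖gradient f x‖ ≤ C
  gradient_dominated : ∀ x ∈ F, 2 * μ * (f x - fopt) ≤ ‖gradient f x‖ ^ 2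
  step_mem : ∀ x ∈ F, ∀ e, ‖e‖ ^ 2 ≤ ε → x - η • (gradient f x + e) ∈ F
  step_le : ∀ x ∈ F, ∀ e, ‖e‖ ^ 2 ≤ ε → f (x - η • (gradient f x + e)) ≤
    f x - η * inner ℝ (gradient f x) (gradient f x + e) + L * η ^ 2 * ‖gradient f x + e‖ ^ 2

theorem pagd_succ (hG : G ≠ 0) (hs : s t ≠ 0) (ν : ℕ → E) :
    pagd f G η s x₀ ν (t + 1) = pagd f G η s x₀ ν t -
      η • (gradient f (pagd f G η s x₀ ν t) + (G / s t) • ν t) := by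
  have h_scale : G / s t * (s t * G⁻¹) = 1 := by field_simp
  rw [pagd, dec, enc, smul_smul (s t), smul_add (G / s t), smul_smul (G / s t), h_scale, one_smul]

theorem pagd_congr {ν ν' : ℕ → E} (h : ∀ i < t, ν i = ν' i) :
    pagd f G η s x₀ ν t = pagd f G η s x₀ ν' t := by
  induction t with
  | zero => rfl
  | succ t ih => rw [pagd, pagd, ih fun i hi => h i (hi.trans t.lt_succ_self), h t t.lt_succ_self]

theorem IsDescentRegion.pagd_mem (hF : IsDescentRegion f F fopt μ L η ε) (hG : G ≠ 0)
    (hs : ∀ t < T, s t ≠ 0) (hx₀ : x₀ ∈ F) {ν : ℕ → E}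
    (hν : ∀ t < T, ‖(G / s t) • ν t‖ ^ 2 ≤ ε) : ∀ t ≤ T, pagd f G η s x₀ ν t ∈ F
  | 0, _ => hx₀
  | t + 1, ht => by
    rw [pagd_succ hG (hs t ht)]
    exact hF.step_mem _ (hF.pagd_mem hG hs hx₀ hν t (by omega)) _ (hν t ht)

variable {Ω : Type*} [MeasurableSpace Ω] {P : Measure Ω} {ν : ℕ → Ω → E}

theorem IsDescentRegion.ae_pagd_mem (hF : IsDescentRegion f F fopt μ L η ε) (hG : G ≠ 0)
    (hs : ∀ t < T, s t ≠ 0) (hx₀ : x₀ ∈ F) (hνε : ∀ t < T, ∀ᵐ ω ∂P, ‖(G / s t) • ν t ω‖ ^ 2 ≤ ε) :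
    ∀ᵐ ω ∂P, ∀ t ≤ T, pagd f G η s x₀ (fun i => ν i ω) t ∈ F := by
  have h_small : ∀ᵐ ω ∂P, ∀ t, t < T → ‖(G / s t) • ν t ω‖ ^ 2 ≤ ε :=
    ae_all_iff.2 fun t => Filter.eventually_imp_distrib_left.2 (hνε t)
  filter_upwards [h_small] with ω hω using hF.pagd_mem hG hs hx₀ hω

variable [MeasurableSpace E] [BorelSpace E]

theorem measurable_gradient (f : E → ℝ) : Measurable (gradient f) :=
  (InnerProductSpace.toDual ℝ E).symm.continuous.measurable.comp (measurable_fderiv ℝ f)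

theorem measurable_pagd [SecondCountableTopology E] (t : ℕ) :
    Measurable fun ν : ℕ → E => pagd f G η s x₀ ν t := by
  induction t with
  | zero => exact measurable_const
  | succ t ih =>
    have h_grad := (measurable_gradient f).comp ih
    have h_noise : Measurable fun ν : ℕ → E => ν t := measurable_pi_apply t
    exact ih.sub <|
      (((h_grad.const_smul G⁻¹).const_smul (s t)).add h_noise).const_smul (G / s t) |>.const_smul η

theorem indepFun_pagd [SecondCountableTopology E] (hν : ∀ t, Measurable (ν t))
    (hind : iIndepFun ν P) (t : ℕ) :
    IndepFun (fun ω => pagd f G η s x₀ (fun i => ν i ω) t) (ν t) P := by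
  let extend : (Finset.range t → E) → ℕ → E := fun y i =>
    if hi : i ∈ Finset.range t then y ⟨i, hi⟩ else 0
  have h_extend : Measurable extend := by
    refine measurable_pi_lambda _ fun i => ?_
    by_cases hi : i ∈ Finset.range t
    · simpa only [extend, dif_pos hi] using measurable_pi_apply _
    · simp only [extend, dif_neg hi, measurable_const]
  have h_past : (fun ω => pagd f G η s x₀ (fun i => ν i ω) t) =
      fun ω => pagd f G η s x₀ (extend fun i => ν i ω) t := by
    funext ω
    exact pagd_congr fun i hi => by simp only [extend, dif_pos (Finset.mem_range.2 hi)]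
  rw [h_past]
  exact (hind.indepFun_finset (Finset.range t) {t} (by simp) hν).comp
    ((measurable_pagd t).comp h_extend)
    (measurable_pi_apply (⟨t, Finset.mem_singleton_self t⟩ : ({t} : Finset ℕ)))

namespace IsDescentRegion

variable [SecondCountableTopology E]

theorem integrable_pagd [IsFiniteMeasure P] (hF : IsDescentRegion f F fopt μ L η ε) (hG : G ≠ 0)
    (hs : ∀ t < T, s t ≠ 0) (hx₀ : x₀ ∈ F) (hν : ∀ t, Measurable (ν t))
    (hνε : ∀ t < T, ∀ᵐ ω ∂P, ‖(G / s t) • ν t ω‖ ^ 2 ≤ ε) (ht : t ≤ T) :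
    Integrable (fun ω => f (pagd f G η s x₀ (fun i => ν i ω) t)) P :=
  integrable_comp_of_ae_mem ((measurable_pagd t).comp (measurable_pi_lambda _ hν))
    ((hF.ae_pagd_mem hG hs hx₀ hνε).mono fun _ h => h t ht) hF.differentiableAt hF.abs_bdd

theorem integral_pagd_succ_sub_le [IsProbabilityMeasure P]
    (hF : IsDescentRegion f F fopt μ L η ε) (hη : 0 ≤ η) (hLη : 2 * L * η ≤ 1) (hG : G ≠ 0)
    (hs : ∀ t < T, s t ≠ 0) (hx₀ : x₀ ∈ F) (hν : IsBoundedNoise ν P T Δ v)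
    (hνε : ∀ t < T, ∀ᵐ ω ∂P, ‖(G / s t) • ν t ω‖ ^ 2 ≤ ε) (ht : t < T) :
    ∫ ω, (f (pagd f G η s x₀ (fun i => ν i ω) (t + 1)) - fopt) ∂P ≤
      (1 - μ * η) * ∫ ω, (f (pagd f G η s x₀ (fun i => ν i ω) t) - fopt) ∂P +
        L * η ^ 2 * (G / s t) ^ 2 * v := by
  have h_mem := hF.ae_pagd_mem hG hs hx₀ hνε
  have h_int {u : ℕ} (hu : u ≤ T) :=
    (hF.integrable_pagd hG hs hx₀ hν.measurable hνε hu).sub (integrable_const fopt)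
  have h_meas : Measurable fun ω => pagd f G η s x₀ (fun i => ν i ω) t :=
    (measurable_pagd t).comp (measurable_pi_lambda _ hν.measurable)
  obtain ⟨C, hC⟩ := hF.gradient_bdd
  rw [← hν.sq_mean t ht]
  refine integral_le_of_step_le (V := fun ω => gradient f (pagd f G η s x₀ (fun i => ν i ω) t))
    (a := η * (1 - 2 * L * η) * (G / s t)) (h_int ht.le) (h_int ht)
    (.of_bound ((measurable_gradient f).comp h_meas).aestronglyMeasurable C
      (h_mem.mono fun ω hω => hC _ (hω t ht.le)))
    ((indepFun_pagd hν.measurable hν.indep t).comp (measurable_gradient f) measurable_id)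
    (hν.measurable t).aestronglyMeasurable (hν.norm_le t ht) (hν.mean t ht) ?_
  filter_upwards [h_mem, hνε t ht] with ω hω h_err
  have h_step := inexact_step_contraction hη hLη (hF.gradient_dominated _ (hω t ht.le))
    (hF.step_le _ (hω t ht.le) _ h_err)
  rw [← pagd_succ hG (hs t ht) fun i => ν i ω, inner_smul_right, norm_smul, mul_pow,
    Real.norm_eq_abs, sq_abs] at h_step
  exact h_step.trans_eq (by ring)

theorem integral_pagd_sub_le [IsProbabilityMeasure P]
    (hF : IsDescentRegion f F fopt μ L η ε) (hη : 0 ≤ η) (hLη : 2 * L * η ≤ 1) (hμη : μ * η ≤ 1)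
    (hG : G ≠ 0) (hs : ∀ t < T, s t ≠ 0) (hx₀ : x₀ ∈ F) (hν : IsBoundedNoise ν P T Δ v)
    (hνε : ∀ t < T, ∀ᵐ ω ∂P, ‖(G / s t) • ν t ω‖ ^ 2 ≤ ε) :
    ∫ ω, (f (pagd f G η s x₀ (fun i => ν i ω) T) - fopt) ∂P ≤
      (1 - μ * η) ^ T * (f x₀ - fopt) +
        ∑ t ∈ Finset.range T, (1 - μ * η) ^ (T - t - 1) * (L * η ^ 2 * (G / s t) ^ 2 * v) := by
  have h_rec := le_of_affine_recursion
    (a := fun t => ∫ ω, (f (pagd f G η s x₀ (fun i => ν i ω) t) - fopt) ∂P)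
    (b := fun t => L * η ^ 2 * (G / s t) ^ 2 * v) (sub_nonneg.2 hμη) fun t ht =>
    hF.integral_pagd_succ_sub_le hη hLη hG hs hx₀ hν hνε ht
  simpa only [pagd, integral_const, probReal_univ, one_smul] using h_rec

end IsDescentRegion

end NoisyDescent

namespace LQR

variable {n m : ℕ}

/-- Quantitative bounds on the problem data; matrices are compared in the Loewner order. -/
structure Bounded (S : LQR n m) (β₀ σw ψ : ℝ) : Prop where
  β₀_pos : 0 < β₀
  β₀_le_one : β₀ ≤ 1
  σw_pos : 0 < σw
  one_le_ψ : 1 ≤ ψ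
  smul_one_le_Q : β₀ • 1 ≤ S.Q
  smul_one_le_R : β₀ • 1 ≤ S.R
  R_le_one : S.R ≤ 1
  smul_one_le_W : σw ^ 2 • 1 ≤ S.W
  spectralNorm_B_le : spectralNorm S.B ≤ ψ

/-- Stage cost matrix `Q + Kᵀ R K` of the policy `u = K x`. -/
def stageCost (S : LQR n m) (K : Gain m n) : Matrix (Fin n) (Fin n) ℝ :=
  S.Q + K.toMatᵀ * S.R * K.toMat

/-- Value matrix `P_K` of the policy `u = K x`: the solution of `P = Q + Kᵀ R K + Mᵀ P M`, where
`M = A + B K`. -/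
noncomputable def valueMat (S : LQR n m) (K : Gain m n) : Matrix (Fin n) (Fin n) ℝ :=
  lyapunovSolution (S.closedLoop K)ᵀ (S.stageCost K)

/-- The factor `E_K` of the policy gradient `2 E_K Σ_K`: half of the first-order coefficient of the
one-step Bellman cost in the gain, see `bellman_expansion`. -/
noncomputable def gradFactor (S : LQR n m) (K : Gain m n) : Matrix (Fin m) (Fin n) ℝ :=
  S.R * K.toMat + S.Bᵀ * S.valueMat K * S.closedLoop K

/-- The matrix `R + Bᵀ P_K B`: the second-order coefficient of the one-step Bellman cost in the
gain, see `bellman_expansion`. -/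
noncomputable def curvature (S : LQR n m) (K : Gain m n) : Matrix (Fin m) (Fin m) ℝ :=
  S.R + S.Bᵀ * S.valueMat K * S.B

/-- The policy gradient `2 E_K Σ_K`. -/
noncomputable def policyGrad (S : LQR n m) (K : Gain m n) : Gain m n :=
  Gain.ofMat ((2 : ℝ) • (S.gradFactor K * S.stateCov K))

variable {S : LQR n m} {β₀ σw ψ : ℝ} {K K' : Gain m n}

theorem closedLoop_add (S : LQR n m) (K D : Gain m n) :
    S.closedLoop (K + D) = S.closedLoop K + S.B * D.toMat := by
  have h_gain : (K + D).toMat = K.toMat + D.toMat := rfl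
  rw [closedLoop, closedLoop, h_gain, Matrix.mul_add, add_assoc]

namespace Bounded

theorem Q_nonneg (hS : S.Bounded β₀ σw ψ) : 0 ≤ S.Q :=
  (smul_nonneg hS.β₀_pos.le zero_le_one).trans hS.smul_one_le_Q

theorem R_nonneg (hS : S.Bounded β₀ σw ψ) : 0 ≤ S.R :=
  (smul_nonneg hS.β₀_pos.le zero_le_one).trans hS.smul_one_le_R

theorem sq_σw_pos (hS : S.Bounded β₀ σw ψ) : 0 < σw ^ 2 := pow_pos hS.σw_pos 2

theorem W_posDef (hS : S.Bounded β₀ σw ψ) : S.W.PosDef :=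
  posDef_of_smul_one_le hS.sq_σw_pos hS.smul_one_le_W

theorem smul_one_le_stageCost (hS : S.Bounded β₀ σw ψ) (K : Gain m n) :
    β₀ • 1 ≤ S.stageCost K :=
  hS.smul_one_le_Q.trans (le_add_of_nonneg_right (transpose_mul_mul_nonneg hS.R_nonneg _))

theorem stateCov_eq (hS : S.Bounded β₀ σw ψ) (hK : S.Stabilizing K) :
    S.stateCov K = S.W + S.closedLoop K * S.stateCov K * (S.closedLoop K)ᵀ :=
  lyapunovSolution_eq hK hS.W_posDef

theorem smul_one_le_stateCov (hS : S.Bounded β₀ σw ψ) (hK : S.Stabilizing K) :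
    σw ^ 2 • 1 ≤ S.stateCov K :=
  hS.smul_one_le_W.trans <| le_of_eq_lyapunov (isSchurStable_iff_tendsto_pow.1 hK)
    hS.W_posDef.posSemidef.nonneg (hS.stateCov_eq hK)

theorem stateCov_nonneg (hS : S.Bounded β₀ σw ψ) (hK : S.Stabilizing K) : 0 ≤ S.stateCov K :=
  (smul_nonneg hS.sq_σw_pos.le zero_le_one).trans (hS.smul_one_le_stateCov hK)

theorem valueMat_eq (hS : S.Bounded β₀ σw ψ) (hK : S.Stabilizing K) :
    S.valueMat K = S.stageCost K + (S.closedLoop K)ᵀ * S.valueMat K * S.closedLoop K := by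
  simpa [valueMat] using lyapunovSolution_eq
    (isSchurStable_iff_tendsto_pow.2 (tendsto_pow_transpose (isSchurStable_iff_tendsto_pow.1 hK)))
    (posDef_of_smul_one_le hS.β₀_pos (hS.smul_one_le_stageCost K))

theorem valueMat_nonneg (hS : S.Bounded β₀ σw ψ) (hK : S.Stabilizing K) : 0 ≤ S.valueMat K := by
  have h_stage : 0 ≤ S.stageCost K :=
    (smul_nonneg hS.β₀_pos.le zero_le_one).trans (hS.smul_one_le_stageCost K)
  exact h_stage.trans <| le_of_eq_lyapunov
    (tendsto_pow_transpose (isSchurStable_iff_tendsto_pow.1 hK)) h_stage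
    (by simpa using hS.valueMat_eq hK)

theorem cost_eq_trace_valueMat (hS : S.Bounded β₀ σw ψ) (hK : S.Stabilizing K) :
    S.cost K = (S.valueMat K * S.W).trace :=
  trace_mul_eq_trace_mul_of_lyapunov (hS.stateCov_eq hK) (hS.valueMat_eq hK)

theorem trace_stateCov_le (hS : S.Bounded β₀ σw ψ) (hK : S.Stabilizing K) :
    (S.stateCov K).trace ≤ S.cost K / β₀ := by
  rw [le_div_iff₀' hS.β₀_pos]
  simpa [cost, stageCost] using trace_mul_mono (hS.smul_one_le_stageCost K) (hS.stateCov_nonneg hK)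

theorem trace_valueMat_le (hS : S.Bounded β₀ σw ψ) (hK : S.Stabilizing K) :
    (S.valueMat K).trace ≤ S.cost K / σw ^ 2 := by
  rw [le_div_iff₀' hS.sq_σw_pos, hS.cost_eq_trace_valueMat hK, trace_mul_comm]
  simpa using trace_mul_mono hS.smul_one_le_W (hS.valueMat_nonneg hK)

theorem dimension_le_cost (hS : S.Bounded β₀ σw ψ) (hK : S.Stabilizing K) :
    β₀ * σw ^ 2 * n ≤ S.cost K := by
  have h_trace : σw ^ 2 * n ≤ S.cost K / β₀ :=
    (by simpa using trace_mono (hS.smul_one_le_stateCov hK) : σw ^ 2 * n ≤ _).trans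
      (hS.trace_stateCov_le hK)
  rwa [le_div_iff₀' hS.β₀_pos, ← mul_assoc] at h_trace

theorem cost_nonneg (hS : S.Bounded β₀ σw ψ) (hK : S.Stabilizing K) : 0 ≤ S.cost K :=
  (mul_nonneg (mul_nonneg hS.β₀_pos.le hS.sq_σw_pos.le) n.cast_nonneg).trans
    (hS.dimension_le_cost hK)

theorem bellman_expansion (hS : S.Bounded β₀ σw ψ) (hK : S.Stabilizing K)
    (D : Matrix (Fin m) (Fin n) ℝ) :
    S.Q + (K.toMat + D)ᵀ * S.R * (K.toMat + D) +
        (S.closedLoop K + S.B * D)ᵀ * S.valueMat K * (S.closedLoop K + S.B * D) =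
      S.valueMat K + ((S.gradFactor K)ᵀ * D + Dᵀ * S.gradFactor K +
        Dᵀ * S.curvature K * D) := by
  have hR := transpose_eq_of_nonneg hS.R_nonneg
  have hP := transpose_eq_of_nonneg (hS.valueMat_nonneg hK)
  nth_rw 2 [hS.valueMat_eq hK]
  simp only [stageCost, gradFactor, curvature, transpose_add, transpose_mul, transpose_transpose,
    hR, hP, Matrix.mul_add, Matrix.add_mul, Matrix.mul_assoc]
  abel

theorem cost_sub_cost (hS : S.Bounded β₀ σw ψ) (hK : S.Stabilizing K) (hK' : S.Stabilizing K') :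
    S.cost K' - S.cost K =
      (((S.gradFactor K)ᵀ * (K' - K).toMat + (K' - K).toMatᵀ * S.gradFactor K +
        (K' - K).toMatᵀ * S.curvature K * (K' - K).toMat) * S.stateCov K').trace := by
  have h_gain : K'.toMat = K.toMat + (K' - K).toMat := by
    ext i j
    simp [Gain.toMat]
  have h_loop : S.closedLoop K' = S.closedLoop K + S.B * (K' - K).toMat := by
    rw [← closedLoop_add, add_sub_cancel]
  have h_bellman := hS.bellman_expansion hK (K' - K).toMat
  rw [← h_gain, ← h_loop, ← sub_eq_iff_eq_add'] at h_bellman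
  have h_cov : (S.valueMat K * S.stateCov K').trace = S.cost K +
      ((S.closedLoop K')ᵀ * S.valueMat K * S.closedLoop K' * S.stateCov K').trace := by
    nth_rw 1 [hS.stateCov_eq hK']
    rw [Matrix.mul_add, trace_add, hS.cost_eq_trace_valueMat hK,
      Matrix.mul_assoc _ _ (S.stateCov K'), Matrix.mul_assoc (S.closedLoop K')ᵀ,
      trace_mul_comm (S.closedLoop K')ᵀ]
    simp only [Matrix.mul_assoc]
  rw [← h_bellman, Matrix.sub_mul, Matrix.add_mul, trace_sub, trace_add, h_cov, ← cost]
  ring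

/- The Bellman cost of the gain `K - l⁻¹ E_K` is nonnegative. -/
theorem gradFactor_sq_le (hS : S.Bounded β₀ σw ψ) (hK : S.Stabilizing K) {l : ℝ} (hl : 0 < l)
    (h_curv : S.curvature K ≤ l • 1) :
    (S.gradFactor K)ᵀ * S.gradFactor K ≤ l • S.valueMat K := by
  set E := S.gradFactor K
  have h_nonneg (D : Matrix (Fin m) (Fin n) ℝ) :
      0 ≤ S.valueMat K + (Eᵀ * D + Dᵀ * E + Dᵀ * (l • (1 : Matrix (Fin m) (Fin m) ℝ)) * D) :=
    calc 0 ≤ _ := add_nonneg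
          (add_nonneg hS.Q_nonneg (transpose_mul_mul_nonneg hS.R_nonneg (K.toMat + D)))
          (transpose_mul_mul_nonneg (hS.valueMat_nonneg hK) (S.closedLoop K + S.B * D))
      _ = S.valueMat K + (Eᵀ * D + Dᵀ * E + Dᵀ * S.curvature K * D) := hS.bellman_expansion hK D
      _ ≤ _ := by
          gcongr
          exact transpose_mul_mul_mono h_curv D
  rw [← sub_nonneg]
  convert smul_nonneg hl.le (h_nonneg (-(l⁻¹ • E))) using 1
  simp only [transpose_neg, transpose_smul, Matrix.mul_smul, Matrix.smul_mul, Matrix.mul_one,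
    Matrix.mul_neg, Matrix.neg_mul, smul_add, smul_neg, smul_smul, neg_neg, mul_inv_cancel₀ hl.ne',
    one_smul]
  abel

theorem cost_sub_cost_le (hS : S.Bounded β₀ σw ψ) (hK : S.Stabilizing K) (hK' : S.Stabilizing K') :
    S.cost K - S.cost K' ≤
      β₀⁻¹ * ((S.gradFactor K)ᵀ * S.gradFactor K * S.stateCov K').trace := by
  set E := S.gradFactor K
  set D := (K' - K).toMat
  have h_curv : β₀ • (Dᵀ * D) ≤ Dᵀ * S.curvature K * D := by
    have h_le : β₀ • 1 ≤ S.curvature K := hS.smul_one_le_R.trans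
      (le_add_of_nonneg_right (transpose_mul_mul_nonneg (hS.valueMat_nonneg hK) S.B))
    simpa using transpose_mul_mul_mono h_le D
  have h_young := neg_le_mul_mul_transpose_add_swap (zero_le_one' (Matrix (Fin m) (Fin m) ℝ))
    Eᵀ Dᵀ (inv_pos.2 hS.β₀_pos)
  simp only [transpose_transpose, Matrix.mul_one, inv_inv] at h_young
  have h_lower : -(β₀⁻¹ • (Eᵀ * E)) ≤ Eᵀ * D + Dᵀ * E + Dᵀ * S.curvature K * D :=
    calc -(β₀⁻¹ • (Eᵀ * E)) = -(β₀⁻¹ • (Eᵀ * E) + β₀ • (Dᵀ * D)) + β₀ • (Dᵀ * D) := by abel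
      _ ≤ _ := add_le_add h_young h_curv
  have h_trace := trace_mul_mono h_lower (hS.stateCov_nonneg hK')
  rw [← hS.cost_sub_cost hK hK', Matrix.neg_mul, Matrix.smul_mul, trace_neg, trace_smul,
    smul_eq_mul] at h_trace
  linarith

theorem norm_policyGrad_sq (hS : S.Bounded β₀ σw ψ) (hK : S.Stabilizing K) :
    ‖S.policyGrad K‖ ^ 2 =
      4 * ((S.gradFactor K)ᵀ * S.gradFactor K * (S.stateCov K * S.stateCov K)).trace := by
  have h_toMat : (S.policyGrad K).toMat = (2 : ℝ) • (S.gradFactor K * S.stateCov K) := rfl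
  rw [Gain.norm_sq_eq_trace, h_toMat, transpose_smul, transpose_mul,
    transpose_eq_of_nonneg (hS.stateCov_nonneg hK), Matrix.smul_mul, Matrix.mul_smul, smul_smul,
    trace_smul, smul_eq_mul, Matrix.mul_assoc, trace_mul_comm]
  simp only [Matrix.mul_assoc]
  norm_num

theorem trace_gradFactor_sq_le (hS : S.Bounded β₀ σw ψ) (hK : S.Stabilizing K) :
    4 * σw ^ 4 * ((S.gradFactor K)ᵀ * S.gradFactor K).trace ≤ ‖S.policyGrad K‖ ^ 2 := by
  have h_sq : σw ^ 4 • 1 ≤ S.stateCov K * S.stateCov K := by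
    simpa only [← pow_mul] using
      sq_smul_one_le_mul_self hS.sq_σw_pos.le (hS.smul_one_le_stateCov hK)
  have h_trace := trace_mul_mono h_sq (transpose_mul_self_nonneg (S.gradFactor K))
  rw [Matrix.smul_mul, Matrix.one_mul, trace_smul, smul_eq_mul] at h_trace
  rw [hS.norm_policyGrad_sq hK, trace_mul_comm (_ᵀ * _)]
  linarith

theorem cost_sub_cost_le_norm_policyGrad_sq (hS : S.Bounded β₀ σw ψ) (hK : S.Stabilizing K)
    (hK' : S.Stabilizing K') :
    S.cost K - S.cost K' ≤ S.cost K' * (‖S.policyGrad K‖ ^ 2 / (4 * β₀ ^ 2 * σw ^ 4)) := by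
  have hβ := hS.β₀_pos
  have hσ := hS.σw_pos
  have hJ' := hS.cost_nonneg hK'
  set E := S.gradFactor K
  calc S.cost K - S.cost K' ≤ β₀⁻¹ * (Eᵀ * E * S.stateCov K').trace := hS.cost_sub_cost_le hK hK'
    _ ≤ β₀⁻¹ * ((S.cost K' / β₀) * (Eᵀ * E).trace) := by
        gcongr
        have h_cov : S.stateCov K' ≤ (S.cost K' / β₀) • 1 :=
          (le_trace_smul_one (hS.stateCov_nonneg hK')).trans
            (smul_le_smul_of_nonneg_right (hS.trace_stateCov_le hK') zero_le_one)
        rw [trace_mul_comm]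
        simpa using trace_mul_mono h_cov (transpose_mul_self_nonneg E)
    _ = S.cost K' * (4 * σw ^ 4 * (Eᵀ * E).trace / (4 * β₀ ^ 2 * σw ^ 4)) := by field_simp
    _ ≤ _ := by
        gcongr
        exact hS.trace_gradFactor_sq_le hK

theorem dimension_le_optCost (hS : S.Bounded β₀ σw ψ) (hK : S.Stabilizing K) :
    β₀ * σw ^ 2 * n ≤ S.optCost := by
  refine le_csInf ⟨_, K, hK, rfl⟩ ?_
  rintro _ ⟨K', hK', rfl⟩
  exact hS.dimension_le_cost hK'

theorem gradient_domination (hS : S.Bounded β₀ σw ψ) (hK : S.Stabilizing K) :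
    S.cost K - S.optCost ≤ S.optCost * (‖S.policyGrad K‖ ^ 2 / (4 * β₀ ^ 2 * σw ^ 4)) := by
  have hβ := hS.β₀_pos
  have hσ := hS.σw_pos
  set r := ‖S.policyGrad K‖ ^ 2 / (4 * β₀ ^ 2 * σw ^ 4)
  have hr : 0 < 1 + r := by positivity
  suffices S.cost K / (1 + r) ≤ S.optCost by
    rw [div_le_iff₀ hr] at this
    linarith
  refine le_csInf ⟨_, K, hK, rfl⟩ ?_
  rintro _ ⟨K', hK', rfl⟩
  rw [div_le_iff₀ hr]
  linarith [hS.cost_sub_cost_le_norm_policyGrad_sq hK hK']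

section Perturbation

variable {ζ ε : ℝ} {D : Gain m n}

theorem trace_stateCov_le_of_cost_le (hS : S.Bounded β₀ σw ψ) (hK : S.Stabilizing K)
    (hJ : S.cost K ≤ β₀ * σw ^ 2 * ζ ^ 2) : (S.stateCov K).trace ≤ σw ^ 2 * ζ ^ 2 := by
  refine (hS.trace_stateCov_le hK).trans ((div_le_iff₀' hS.β₀_pos).2 ?_)
  rwa [← mul_assoc]

theorem stateCov_le (hS : S.Bounded β₀ σw ψ) (hK : S.Stabilizing K)
    (hJ : S.cost K ≤ β₀ * σw ^ 2 * ζ ^ 2) : S.stateCov K ≤ (σw ^ 2 * ζ ^ 2) • 1 :=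
  (le_trace_smul_one (hS.stateCov_nonneg hK)).trans
    (smul_le_smul_of_nonneg_right (hS.trace_stateCov_le_of_cost_le hK hJ) zero_le_one)

theorem trace_valueMat_le_of_cost_le (hS : S.Bounded β₀ σw ψ) (hK : S.Stabilizing K)
    (hJ : S.cost K ≤ β₀ * σw ^ 2 * ζ ^ 2) : (S.valueMat K).trace ≤ β₀ * ζ ^ 2 := by
  refine (hS.trace_valueMat_le hK).trans ((div_le_iff₀' hS.sq_σw_pos).2 ?_)
  linarith

theorem valueMat_le (hS : S.Bounded β₀ σw ψ) (hK : S.Stabilizing K)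
    (hJ : S.cost K ≤ β₀ * σw ^ 2 * ζ ^ 2) : S.valueMat K ≤ (β₀ * ζ ^ 2) • 1 :=
  (le_trace_smul_one (hS.valueMat_nonneg hK)).trans
    (smul_le_smul_of_nonneg_right (hS.trace_valueMat_le_of_cost_le hK hJ) zero_le_one)

theorem curvature_le (hS : S.Bounded β₀ σw ψ) (hK : S.Stabilizing K)
    (hJ : S.cost K ≤ β₀ * σw ^ 2 * ζ ^ 2) (hζ : 1 ≤ ζ) :
    S.curvature K ≤ (2 * ψ ^ 2 * ζ ^ 2) • 1 := by
  have hβ := hS.β₀_pos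
  have h_input : S.Bᵀ * S.valueMat K * S.B ≤ (β₀ * ζ ^ 2) • ψ ^ 2 • 1 :=
    calc S.Bᵀ * S.valueMat K * S.B ≤ S.Bᵀ * ((β₀ * ζ ^ 2) • 1) * S.B :=
          transpose_mul_mul_mono (hS.valueMat_le hK hJ) S.B
      _ = (β₀ * ζ ^ 2) • (S.Bᵀ * S.B) := by simp
      _ ≤ _ := by
          gcongr
          exact transpose_mul_self_le_of_spectralNorm_le hS.spectralNorm_B_le
  have h_coeff : 1 + β₀ * ζ ^ 2 * ψ ^ 2 ≤ 2 * ψ ^ 2 * ζ ^ 2 := by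
    have h₁ : 1 ≤ ζ ^ 2 * ψ ^ 2 :=
      one_le_mul_of_one_le_of_one_le (one_le_pow₀ hζ) (one_le_pow₀ hS.one_le_ψ)
    nlinarith [hS.β₀_le_one]
  calc S.curvature K ≤ 1 + (β₀ * ζ ^ 2) • ψ ^ 2 • 1 := add_le_add hS.R_le_one h_input
    _ = (1 + β₀ * ζ ^ 2 * ψ ^ 2) • 1 := by rw [smul_smul, add_smul, one_smul]
    _ ≤ _ := smul_le_smul_of_nonneg_right h_coeff zero_le_one

theorem gradFactor_sq_le_valueMat (hS : S.Bounded β₀ σw ψ) (hK : S.Stabilizing K)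
    (hJ : S.cost K ≤ β₀ * σw ^ 2 * ζ ^ 2) (hζ : 1 ≤ ζ) :
    (S.gradFactor K)ᵀ * S.gradFactor K ≤ (2 * ψ ^ 2 * ζ ^ 2) • S.valueMat K :=
  have hψ : 0 < ψ := one_pos.trans_le hS.one_le_ψ
  hS.gradFactor_sq_le hK (by positivity) (hS.curvature_le hK hJ hζ)

theorem trace_gradFactor_sq_mul_stateCov_le (hS : S.Bounded β₀ σw ψ) (hK : S.Stabilizing K)
    (hJ : S.cost K ≤ β₀ * σw ^ 2 * ζ ^ 2) (hζ : 1 ≤ ζ) :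
    ((S.gradFactor K)ᵀ * S.gradFactor K * S.stateCov K).trace ≤ 2 * ψ ^ 2 * σw ^ 2 * ζ ^ 6 := by
  have := hS.β₀_pos
  have h_value : (S.valueMat K * S.stateCov K).trace ≤ σw ^ 2 * ζ ^ 2 * (S.valueMat K).trace := by
    rw [trace_mul_comm]
    simpa using trace_mul_mono (hS.stateCov_le hK hJ) (hS.valueMat_nonneg hK)
  calc ((S.gradFactor K)ᵀ * S.gradFactor K * S.stateCov K).trace
      ≤ 2 * ψ ^ 2 * ζ ^ 2 * (S.valueMat K * S.stateCov K).trace := by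
        simpa using
          trace_mul_mono (hS.gradFactor_sq_le_valueMat hK hJ hζ) (hS.stateCov_nonneg hK)
    _ ≤ 2 * ψ ^ 2 * ζ ^ 2 * (σw ^ 2 * ζ ^ 2 * (1 * ζ ^ 2)) := by
        gcongr
        refine h_value.trans ?_
        gcongr
        exact (hS.trace_valueMat_le_of_cost_le hK hJ).trans (by gcongr; exact hS.β₀_le_one)
    _ = 2 * ψ ^ 2 * σw ^ 2 * ζ ^ 6 := by ring

theorem norm_policyGrad_le (hS : S.Bounded β₀ σw ψ) (hK : S.Stabilizing K)
    (hJ : S.cost K ≤ β₀ * σw ^ 2 * ζ ^ 2) (hζ : 1 ≤ ζ) :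
    ‖S.policyGrad K‖ ≤ 3 * ψ * σw ^ 2 * ζ ^ 4 := by
  have hψ : 0 < ψ := one_pos.trans_le hS.one_le_ψ
  have h_cov := trace_mul_mono (mul_self_le_smul (hS.stateCov_nonneg hK) (hS.stateCov_le hK hJ))
    (transpose_mul_self_nonneg (S.gradFactor K))
  rw [Matrix.smul_mul, trace_smul, smul_eq_mul, trace_mul_comm, trace_mul_comm (S.stateCov K)]
    at h_cov
  refine le_of_sq_le_sq ?_ (by positivity)
  rw [hS.norm_policyGrad_sq hK]
  calc 4 * ((S.gradFactor K)ᵀ * S.gradFactor K * (S.stateCov K * S.stateCov K)).trace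
      ≤ 4 * (σw ^ 2 * ζ ^ 2 * (2 * ψ ^ 2 * σw ^ 2 * ζ ^ 6)) := by
        gcongr
        refine h_cov.trans ?_
        gcongr
        exact hS.trace_gradFactor_sq_mul_stateCov_le hK hJ hζ
    _ = 8 * (ψ * σw ^ 2 * ζ ^ 4) ^ 2 := by ring
    _ ≤ 9 * (ψ * σw ^ 2 * ζ ^ 4) ^ 2 := by gcongr; norm_num
    _ = (3 * ψ * σw ^ 2 * ζ ^ 4) ^ 2 := by ring

theorem closedLoop_conj_stateCov_le (hS : S.Bounded β₀ σw ψ) (hK : S.Stabilizing K)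
    (hJ : S.cost K ≤ β₀ * σw ^ 2 * ζ ^ 2) (hζ : 1 ≤ ζ) :
    S.closedLoop K * S.stateCov K * (S.closedLoop K)ᵀ ≤ (1 - (ζ ^ 2)⁻¹) • S.stateCov K := by
  refine mul_mul_transpose_le_of_lyapunov (hS.stateCov_eq hK) ?_
  have hζ₀ : ζ ≠ 0 := by positivity
  calc (ζ ^ 2)⁻¹ • S.stateCov K ≤ (ζ ^ 2)⁻¹ • (σw ^ 2 * ζ ^ 2) • 1 := by
        gcongr
        exact hS.stateCov_le hK hJ
    _ = σw ^ 2 • 1 := by rw [smul_smul]; congr 1; field_simp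
    _ ≤ S.W := hS.smul_one_le_W

theorem input_conj_stateCov_le (hS : S.Bounded β₀ σw ψ) (hK : S.Stabilizing K)
    (hJ : S.cost K ≤ β₀ * σw ^ 2 * ζ ^ 2) :
    S.B * D.toMat * S.stateCov K * (S.B * D.toMat)ᵀ ≤ (ψ * ‖D‖ * ζ) ^ 2 • S.stateCov K := by
  calc S.B * D.toMat * S.stateCov K * (S.B * D.toMat)ᵀ
      ≤ S.B * D.toMat * ((σw ^ 2 * ζ ^ 2) • 1) * (S.B * D.toMat)ᵀ :=
        mul_mul_transpose_mono (hS.stateCov_le hK hJ) _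
    _ = (σw ^ 2 * ζ ^ 2) • (S.B * (D.toMat * D.toMatᵀ) * S.Bᵀ) := by
        simp [Matrix.mul_assoc]
    _ ≤ (σw ^ 2 * ζ ^ 2) • ‖D‖ ^ 2 • (S.B * S.Bᵀ) := by
        gcongr
        simpa using mul_mul_transpose_mono D.mul_transpose_self_le S.B
    _ ≤ (σw ^ 2 * ζ ^ 2) • ‖D‖ ^ 2 • ψ ^ 2 • 1 := by
        gcongr
        exact mul_transpose_self_le_of_spectralNorm_le hS.spectralNorm_B_le
    _ = (ψ * ‖D‖ * ζ) ^ 2 • σw ^ 2 • 1 := by simp only [smul_smul]; ring_nf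
    _ ≤ (ψ * ‖D‖ * ζ) ^ 2 • S.stateCov K := by
        gcongr
        exact hS.smul_one_le_stateCov hK

theorem input_conj_stateCov_le_of_le (hS : S.Bounded β₀ σw ψ) (hK : S.Stabilizing K)
    (hJ : S.cost K ≤ β₀ * σw ^ 2 * ζ ^ 2) (hζ : 0 ≤ ζ) (hD : ψ * ‖D‖ * ζ ≤ ε) :
    S.B * D.toMat * S.stateCov K * (S.B * D.toMat)ᵀ ≤ ε ^ 2 • S.stateCov K := by
  have hψ : 0 < ψ := one_pos.trans_le hS.one_le_ψ
  exact (hS.input_conj_stateCov_le hK hJ).trans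
    (smul_le_smul_of_nonneg_right (by gcongr) (hS.stateCov_nonneg hK))

theorem closedLoop_conj_stateCov_le_self (hS : S.Bounded β₀ σw ψ) (hK : S.Stabilizing K) :
    S.closedLoop K * S.stateCov K * (S.closedLoop K)ᵀ ≤ S.stateCov K := by
  nth_rw 2 [hS.stateCov_eq hK]
  exact le_add_of_nonneg_left hS.W_posDef.posSemidef.nonneg

theorem closedLoop_add_conj_sub_le (hS : S.Bounded β₀ σw ψ) (hK : S.Stabilizing K)
    (hJ : S.cost K ≤ β₀ * σw ^ 2 * ζ ^ 2) (hζ : 1 ≤ ζ) (hε : 0 < ε) (hD : ψ * ‖D‖ * ζ ≤ ε)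
    (hεζ : 6 * ε * ζ ^ 2 ≤ 1) :
    S.closedLoop (K + D) * S.stateCov K * (S.closedLoop (K + D))ᵀ -
      S.closedLoop K * S.stateCov K * (S.closedLoop K)ᵀ ≤ (3 * ε) • S.stateCov K := by
  have hε₁ : ε ≤ 1 := by nlinarith [one_le_pow₀ hζ (n := 2)]
  rw [closedLoop_add]
  exact add_mul_mul_transpose_sub_le (hS.stateCov_nonneg hK)
    (hS.closedLoop_conj_stateCov_le_self hK)
    (hS.input_conj_stateCov_le_of_le hK hJ (by positivity) hD) hε hε₁

theorem closedLoop_add_conj_stateCov_le (hS : S.Bounded β₀ σw ψ) (hK : S.Stabilizing K)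
    (hJ : S.cost K ≤ β₀ * σw ^ 2 * ζ ^ 2) (hζ : 1 ≤ ζ) (hε : 0 < ε) (hD : ψ * ‖D‖ * ζ ≤ ε)
    (hεζ : 6 * ε * ζ ^ 2 ≤ 1) :
    S.closedLoop (K + D) * S.stateCov K * (S.closedLoop (K + D))ᵀ ≤
      (1 - (2 * ζ ^ 2)⁻¹) • S.stateCov K := by
  have h_coeff : 1 - (ζ ^ 2)⁻¹ + 3 * ε ≤ 1 - (2 * ζ ^ 2)⁻¹ := by
    have h_slack : 3 * ε ≤ (2 * ζ ^ 2)⁻¹ := by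
      field_simp
      linarith
    have h_half : (ζ ^ 2)⁻¹ = 2 * (2 * ζ ^ 2)⁻¹ := by field_simp
    linarith
  calc S.closedLoop (K + D) * S.stateCov K * (S.closedLoop (K + D))ᵀ
      = S.closedLoop K * S.stateCov K * (S.closedLoop K)ᵀ +
        (S.closedLoop (K + D) * S.stateCov K * (S.closedLoop (K + D))ᵀ -
          S.closedLoop K * S.stateCov K * (S.closedLoop K)ᵀ) := by abel
    _ ≤ (1 - (ζ ^ 2)⁻¹) • S.stateCov K + (3 * ε) • S.stateCov K :=
        add_le_add (hS.closedLoop_conj_stateCov_le hK hJ hζ)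
          (hS.closedLoop_add_conj_sub_le hK hJ hζ hε hD hεζ)
    _ = (1 - (ζ ^ 2)⁻¹ + 3 * ε) • S.stateCov K := (add_smul _ _ _).symm
    _ ≤ _ := smul_le_smul_of_nonneg_right h_coeff (hS.stateCov_nonneg hK)

theorem stabilizing_add (hS : S.Bounded β₀ σw ψ) (hK : S.Stabilizing K)
    (hJ : S.cost K ≤ β₀ * σw ^ 2 * ζ ^ 2) (hζ : 1 ≤ ζ) (hD : 6 * (ψ * ‖D‖ * ζ ^ 3) ≤ 1) :
    S.Stabilizing (K + D) := by
  have hζ₀ : 0 < ζ := one_pos.trans_le hζ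
  have hε : ψ * ‖D‖ * ζ ≤ (6 * ζ ^ 2)⁻¹ := by
    field_simp
    linarith
  have h_contr := hS.closedLoop_add_conj_stateCov_le hK hJ hζ (by positivity) hε
    (by field_simp; norm_num)
  have h_inv : (2 * ζ ^ 2)⁻¹ ≤ 1 := inv_le_one_of_one_le₀ (by nlinarith)
  exact isSchurStable_iff_tendsto_pow.2 <| tendsto_pow_of_contraction hS.sq_σw_pos
    (hS.smul_one_le_stateCov hK) (sub_nonneg.2 h_inv) (sub_lt_self 1 (by positivity)) h_contr

theorem stateCov_add_sub_le (hS : S.Bounded β₀ σw ψ) (hK : S.Stabilizing K)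
    (hKD : S.Stabilizing (K + D)) (hJ : S.cost K ≤ β₀ * σw ^ 2 * ζ ^ 2) (hζ : 1 ≤ ζ) (hε : 0 < ε)
    (hD : ψ * ‖D‖ * ζ ≤ ε) (hεζ : 6 * ε * ζ ^ 2 ≤ 1) :
    S.stateCov (K + D) - S.stateCov K ≤ (6 * ε * ζ ^ 2) • S.stateCov K ∧
      -((6 * ε * ζ ^ 2) • S.stateCov K) ≤ S.stateCov (K + D) - S.stateCov K := by
  have : 0 < ζ := one_pos.trans_le hζ
  have h_pow := isSchurStable_iff_tendsto_pow.1 hKD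
  have h_contr := hS.closedLoop_add_conj_stateCov_le hK hJ hζ hε hD hεζ
  have h_sub := lyapunov_sub_eq (hS.stateCov_eq hK) (hS.stateCov_eq hKD)
  have h_upper := hS.closedLoop_add_conj_sub_le hK hJ hζ hε hD hεζ
  have h_lower := neg_le_add_mul_mul_transpose_sub (hS.stateCov_nonneg hK)
    (hS.closedLoop_conj_stateCov_le_self hK)
    (hS.input_conj_stateCov_le_of_le hK hJ (by positivity) hD) hε
  rw [← closedLoop_add] at h_lower
  have h_ratio : 3 * ε / (2 * ζ ^ 2)⁻¹ = 6 * ε * ζ ^ 2 := by field_simp; norm_num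
  rw [← h_ratio]
  refine ⟨le_of_lyapunov_of_contraction h_pow h_sub h_upper (by positivity) (by positivity) h_contr,
    neg_le.1 <| le_of_lyapunov_of_contraction h_pow ?_ (neg_le.1 h_lower) (by positivity)
      (by positivity) h_contr⟩
  nth_rw 1 [h_sub]
  rw [Matrix.mul_neg, Matrix.neg_mul, ← neg_add]

theorem inner_policyGrad (hS : S.Bounded β₀ σw ψ) (hK : S.Stabilizing K) (D : Gain m n) :
    inner ℝ (S.policyGrad K) D =
      (((S.gradFactor K)ᵀ * D.toMat + D.toMatᵀ * S.gradFactor K) * S.stateCov K).trace := by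
  have h_toMat : (S.policyGrad K).toMat = (2 : ℝ) • (S.gradFactor K * S.stateCov K) := rfl
  have h_symm := transpose_eq_of_nonneg (hS.stateCov_nonneg hK)
  have h_swap : (D.toMatᵀ * S.gradFactor K * S.stateCov K).trace =
      ((S.gradFactor K)ᵀ * D.toMat * S.stateCov K).trace := by
    rw [← trace_transpose, transpose_mul, transpose_mul, transpose_transpose, h_symm,
      trace_mul_comm]
  rw [Gain.inner_eq_trace, h_toMat, transpose_smul, transpose_mul, h_symm, Matrix.smul_mul,
    trace_smul, Matrix.mul_assoc, trace_mul_comm, Matrix.add_mul, trace_add, h_swap, smul_eq_mul,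
    two_mul]

theorem cost_add_sub_inner (hS : S.Bounded β₀ σw ψ) (hK : S.Stabilizing K)
    (hKD : S.Stabilizing (K + D)) :
    S.cost (K + D) - S.cost K - inner ℝ (S.policyGrad K) D =
      (((S.gradFactor K)ᵀ * D.toMat + D.toMatᵀ * S.gradFactor K) *
        (S.stateCov (K + D) - S.stateCov K)).trace +
      (D.toMatᵀ * S.curvature K * D.toMat * S.stateCov (K + D)).trace := by
  rw [hS.cost_sub_cost hK hKD, hS.inner_policyGrad hK, add_sub_cancel_left,
    Matrix.add_mul _ _ (S.stateCov (K + D)), trace_add, Matrix.mul_sub, trace_sub]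
  ring

theorem trace_transpose_mul_self_mul_stateCov_le (hS : S.Bounded β₀ σw ψ) (hK : S.Stabilizing K)
    (hJ : S.cost K ≤ β₀ * σw ^ 2 * ζ ^ 2) (D : Gain m n) :
    (D.toMatᵀ * D.toMat * S.stateCov K).trace ≤ σw ^ 2 * ζ ^ 2 * ‖D‖ ^ 2 := by
  rw [Gain.norm_sq_eq_trace, trace_mul_comm]
  simpa using trace_mul_mono (hS.stateCov_le hK hJ) (transpose_mul_self_nonneg D.toMat)

theorem abs_trace_cross_le (hS : S.Bounded β₀ σw ψ) (hK : S.Stabilizing K)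
    (hKD : S.Stabilizing (K + D)) (hJ : S.cost K ≤ β₀ * σw ^ 2 * ζ ^ 2) (hζ : 1 ≤ ζ) (hD₀ : D ≠ 0)
    (hD : 6 * (ψ * ‖D‖ * ζ ^ 3) ≤ 1) :
    |(((S.gradFactor K)ᵀ * D.toMat + D.toMatᵀ * S.gradFactor K) *
      (S.stateCov (K + D) - S.stateCov K)).trace| ≤ 18 * ψ ^ 2 * σw ^ 2 * ζ ^ 7 * ‖D‖ ^ 2 := by
  have hψ : 0 < ψ := one_pos.trans_le hS.one_le_ψ
  have : 0 < ζ := one_pos.trans_le hζ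
  have : 0 < ‖D‖ := norm_pos_iff.2 hD₀
  set E := S.gradFactor K
  have ha : 0 < ‖D‖ / (ψ * ζ ^ 2) := by positivity
  have h_diff := hS.stateCov_add_sub_le hK hKD hJ hζ (by positivity) le_rfl (by linarith)
  have h_upper := mul_mul_transpose_add_swap_le (zero_le_one' (Matrix (Fin m) (Fin m) ℝ))
    Eᵀ D.toMatᵀ ha
  have h_lower := neg_le_mul_mul_transpose_add_swap (zero_le_one' (Matrix (Fin m) (Fin m) ℝ))
    Eᵀ D.toMatᵀ ha
  simp only [transpose_transpose, Matrix.mul_one] at h_upper h_lower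
  calc _ ≤ 6 * (ψ * ‖D‖ * ζ) * ζ ^ 2 * (‖D‖ / (ψ * ζ ^ 2) * (Eᵀ * E * S.stateCov K).trace +
        (‖D‖ / (ψ * ζ ^ 2))⁻¹ * (D.toMatᵀ * D.toMat * S.stateCov K).trace) := by
        simpa [Matrix.add_mul] using abs_trace_mul_le_of_abs_le h_upper h_lower h_diff.1 h_diff.2
    _ ≤ 6 * (ψ * ‖D‖ * ζ) * ζ ^ 2 * (‖D‖ / (ψ * ζ ^ 2) * (2 * ψ ^ 2 * σw ^ 2 * ζ ^ 6) +
        (‖D‖ / (ψ * ζ ^ 2))⁻¹ * (σw ^ 2 * ζ ^ 2 * ‖D‖ ^ 2)) := by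
        gcongr
        · exact hS.trace_gradFactor_sq_mul_stateCov_le hK hJ hζ
        · exact hS.trace_transpose_mul_self_mul_stateCov_le hK hJ D
    _ = 18 * ψ ^ 2 * σw ^ 2 * ζ ^ 7 * ‖D‖ ^ 2 := by field_simp; ring

theorem stateCov_add_le (hS : S.Bounded β₀ σw ψ) (hK : S.Stabilizing K)
    (hKD : S.Stabilizing (K + D)) (hJ : S.cost K ≤ β₀ * σw ^ 2 * ζ ^ 2) (hζ : 1 ≤ ζ)
    (hD₀ : D ≠ 0) (hD : 6 * (ψ * ‖D‖ * ζ ^ 3) ≤ 1) :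
    S.stateCov (K + D) ≤ (2 : ℝ) • S.stateCov K := by
  have hψ : 0 < ψ := one_pos.trans_le hS.one_le_ψ
  have : 0 < ‖D‖ := norm_pos_iff.2 hD₀
  have h_diff := (hS.stateCov_add_sub_le hK hKD hJ hζ (by positivity) le_rfl (by linarith)).1
  rw [sub_le_iff_le_add] at h_diff
  calc S.stateCov (K + D) ≤ _ := h_diff
    _ ≤ (1 : ℝ) • S.stateCov K + S.stateCov K := by
        gcongr
        · exact hS.stateCov_nonneg hK
        · linarith
    _ = (2 : ℝ) • S.stateCov K := by rw [one_smul, two_smul]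

theorem abs_trace_curvature_le (hS : S.Bounded β₀ σw ψ) (hK : S.Stabilizing K)
    (hKD : S.Stabilizing (K + D)) (hJ : S.cost K ≤ β₀ * σw ^ 2 * ζ ^ 2) (hζ : 1 ≤ ζ) (hD₀ : D ≠ 0)
    (hD : 6 * (ψ * ‖D‖ * ζ ^ 3) ≤ 1) :
    |(D.toMatᵀ * S.curvature K * D.toMat * S.stateCov (K + D)).trace| ≤
      4 * ψ ^ 2 * σw ^ 2 * ζ ^ 4 * ‖D‖ ^ 2 := by
  have h_curv_nonneg : 0 ≤ S.curvature K :=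
    add_nonneg hS.R_nonneg (transpose_mul_mul_nonneg (hS.valueMat_nonneg hK) S.B)
  have h_conj_nonneg := transpose_mul_mul_nonneg h_curv_nonneg D.toMat
  have h_conj_le : D.toMatᵀ * S.curvature K * D.toMat ≤
      (2 * ψ ^ 2 * ζ ^ 2) • (D.toMatᵀ * D.toMat) := by
    simpa using transpose_mul_mul_mono (hS.curvature_le hK hJ hζ) D.toMat
  rw [abs_of_nonneg (trace_mul_nonneg h_conj_nonneg (hS.stateCov_nonneg hKD))]
  calc _ ≤ 2 * (D.toMatᵀ * S.curvature K * D.toMat * S.stateCov K).trace := by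
        rw [trace_mul_comm, trace_mul_comm _ (S.stateCov K)]
        simpa using trace_mul_mono (hS.stateCov_add_le hK hKD hJ hζ hD₀ hD) h_conj_nonneg
    _ ≤ 2 * (2 * ψ ^ 2 * ζ ^ 2 * (D.toMatᵀ * D.toMat * S.stateCov K).trace) := by
        gcongr
        simpa using trace_mul_mono h_conj_le (hS.stateCov_nonneg hK)
    _ ≤ 2 * (2 * ψ ^ 2 * ζ ^ 2 * (σw ^ 2 * ζ ^ 2 * ‖D‖ ^ 2)) := by
        gcongr
        exact hS.trace_transpose_mul_self_mul_stateCov_le hK hJ D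
    _ = 4 * ψ ^ 2 * σw ^ 2 * ζ ^ 4 * ‖D‖ ^ 2 := by ring

theorem abs_cost_add_sub_inner_le (hS : S.Bounded β₀ σw ψ) (hK : S.Stabilizing K)
    (hJ : S.cost K ≤ β₀ * σw ^ 2 * ζ ^ 2) (hζ : 1 ≤ ζ) (hD : 6 * (ψ * ‖D‖ * ζ ^ 3) ≤ 1) :
    |S.cost (K + D) - S.cost K - inner ℝ (S.policyGrad K) D| ≤
      22 * ψ ^ 2 * σw ^ 2 * ζ ^ 7 * ‖D‖ ^ 2 := by
  rcases eq_or_ne D 0 with rfl | hD₀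
  · simp
  have hKD := hS.stabilizing_add hK hJ hζ hD
  have h_pow : ζ ^ 4 ≤ ζ ^ 7 := pow_le_pow_right₀ hζ (by norm_num)
  rw [hS.cost_add_sub_inner hK hKD]
  calc _ ≤ 18 * ψ ^ 2 * σw ^ 2 * ζ ^ 7 * ‖D‖ ^ 2 + 4 * ψ ^ 2 * σw ^ 2 * ζ ^ 4 * ‖D‖ ^ 2 :=
        (abs_add_le _ _).trans <| add_le_add (hS.abs_trace_cross_le hK hKD hJ hζ hD₀ hD)
          (hS.abs_trace_curvature_le hK hKD hJ hζ hD₀ hD)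
    _ ≤ 18 * ψ ^ 2 * σw ^ 2 * ζ ^ 7 * ‖D‖ ^ 2 + 4 * ψ ^ 2 * σw ^ 2 * ζ ^ 7 * ‖D‖ ^ 2 := by gcongr
    _ = 22 * ψ ^ 2 * σw ^ 2 * ζ ^ 7 * ‖D‖ ^ 2 := by ring

end Perturbation

section GradientStep

variable {ζ μ L η : ℝ} {e : Gain m n}

theorem hasGradientAt_cost (hS : S.Bounded β₀ σw ψ) (hK : S.Stabilizing K)
    (hJ : S.cost K ≤ β₀ * σw ^ 2 * ζ ^ 2) (hζ : 1 ≤ ζ) :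
    HasGradientAt S.cost (S.policyGrad K) K := by
  have h_small : ∀ᶠ D : Gain m n in 𝓝 0, 6 * (ψ * ‖D‖ * ζ ^ 3) ≤ 1 := by
    have h_cont : Continuous fun D : Gain m n => 6 * (ψ * ‖D‖ * ζ ^ 3) := by fun_prop
    exact (h_cont.tendsto' 0 0 (by simp)).eventually_le_const one_pos
  have h_remainder : (fun D : Gain m n => S.cost (K + D) - S.cost K - inner ℝ (S.policyGrad K) D)
      =O[𝓝 0] fun D => ‖D‖ ^ 2 := by
    refine .of_bound (22 * ψ ^ 2 * σw ^ 2 * ζ ^ 7) ?_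
    filter_upwards [h_small] with D hD
    rw [Real.norm_eq_abs, norm_pow, norm_norm]
    exact hS.abs_cost_add_sub_inner_le hK hJ hζ hD
  rw [hasGradientAt_iff_isLittleO_nhds_zero]
  exact h_remainder.trans_isLittleO (Asymptotics.isLittleO_norm_pow_id one_lt_two)

theorem gradient_cost (hS : S.Bounded β₀ σw ψ) (hK : S.Stabilizing K)
    (hJ : S.cost K ≤ β₀ * σw ^ 2 * ζ ^ 2) (hζ : 1 ≤ ζ) : gradient S.cost K = S.policyGrad K :=
  (hS.hasGradientAt_cost hK hJ hζ).gradient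

theorem mul_cost_sub_optCost_le (hS : S.Bounded β₀ σw ψ) (hK : S.Stabilizing K)
    (hopt : S.optCost ≤ β₀ * σw ^ 2 * ζ ^ 2) (hμ₀ : 0 ≤ μ) (hμ : μ * ζ ^ 2 ≤ 2 * β₀ * σw ^ 2) :
    2 * μ * (S.cost K - S.optCost) ≤ ‖S.policyGrad K‖ ^ 2 := by
  have hβ := hS.β₀_pos
  have hσ := hS.σw_pos
  calc 2 * μ * (S.cost K - S.optCost)
      ≤ 2 * μ * (β₀ * σw ^ 2 * ζ ^ 2 * (‖S.policyGrad K‖ ^ 2 / (4 * β₀ ^ 2 * σw ^ 4))) := by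
        gcongr
        exact (hS.gradient_domination hK).trans (by gcongr)
    _ = μ * ζ ^ 2 * (2 * β₀ * σw ^ 2 * (‖S.policyGrad K‖ ^ 2 / (4 * β₀ ^ 2 * σw ^ 4))) := by ring
    _ ≤ 2 * β₀ * σw ^ 2 * (2 * β₀ * σw ^ 2 * (‖S.policyGrad K‖ ^ 2 / (4 * β₀ ^ 2 * σw ^ 4))) := by
        gcongr
    _ = ‖S.policyGrad K‖ ^ 2 := by field_simp; ring

theorem norm_error_le (hS : S.Bounded β₀ σw ψ) (hζ : 1 ≤ ζ) (hμ : μ * ζ ^ 2 ≤ 2 * β₀ * σw ^ 2)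
    (he : ‖e‖ ^ 2 ≤ μ * (β₀ * σw ^ 2 * ζ ^ 2) / 2) : ‖e‖ ≤ ψ * σw ^ 2 * ζ ^ 4 := by
  have hβ := hS.β₀_pos
  have hψ : 0 < ψ := one_pos.trans_le hS.one_le_ψ
  have h_norm : ‖e‖ ≤ β₀ * σw ^ 2 := by
    refine le_of_sq_le_sq ?_ (by positivity)
    calc ‖e‖ ^ 2 ≤ β₀ * σw ^ 2 / 2 * (μ * ζ ^ 2) := he.trans_eq (by ring)
      _ ≤ β₀ * σw ^ 2 / 2 * (2 * β₀ * σw ^ 2) := by gcongr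
      _ = (β₀ * σw ^ 2) ^ 2 := by ring
  calc ‖e‖ ≤ β₀ * σw ^ 2 * 1 := by rwa [mul_one]
    _ ≤ ψ * σw ^ 2 * ζ ^ 4 := by
        gcongr
        · exact hS.β₀_le_one.trans hS.one_le_ψ
        · exact one_le_pow₀ hζ

theorem step_small (hS : S.Bounded β₀ σw ψ) (hK : S.Stabilizing K)
    (hJ : S.cost K ≤ β₀ * σw ^ 2 * ζ ^ 2) (hζ : 1 ≤ ζ) (hη : 0 ≤ η)
    (hL : 22 * ψ ^ 2 * σw ^ 2 * ζ ^ 7 ≤ L) (hLη : 2 * L * η ≤ 1) (he : ‖e‖ ≤ ψ * σw ^ 2 * ζ ^ 4) :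
    6 * (ψ * ‖-(η • (S.policyGrad K + e))‖ * ζ ^ 3) ≤ 1 := by
  have hψ : 0 < ψ := one_pos.trans_le hS.one_le_ψ
  have h_norm : ‖S.policyGrad K + e‖ ≤ 4 * (ψ * σw ^ 2 * ζ ^ 4) := by
    linarith [norm_add_le (S.policyGrad K) e, hS.norm_policyGrad_le hK hJ hζ]
  rw [norm_neg, norm_smul, Real.norm_of_nonneg hη]
  calc 6 * (ψ * (η * ‖S.policyGrad K + e‖) * ζ ^ 3)
      ≤ 6 * (ψ * (η * (4 * (ψ * σw ^ 2 * ζ ^ 4))) * ζ ^ 3) := by gcongr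
    _ = 24 * ψ ^ 2 * σw ^ 2 * ζ ^ 7 * η := by ring
    _ ≤ 44 * ψ ^ 2 * σw ^ 2 * ζ ^ 7 * η := by gcongr; norm_num
    _ = 2 * (22 * ψ ^ 2 * σw ^ 2 * ζ ^ 7) * η := by ring
    _ ≤ 2 * L * η := by gcongr
    _ ≤ 1 := hLη

theorem cost_step_le (hS : S.Bounded β₀ σw ψ) (hK : S.Stabilizing K)
    (hJ : S.cost K ≤ β₀ * σw ^ 2 * ζ ^ 2) (hζ : 1 ≤ ζ) (hη : 0 ≤ η)
    (hL : 22 * ψ ^ 2 * σw ^ 2 * ζ ^ 7 ≤ L) (hLη : 2 * L * η ≤ 1) (he : ‖e‖ ≤ ψ * σw ^ 2 * ζ ^ 4) :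
    S.cost (K - η • (S.policyGrad K + e)) ≤
      S.cost K - η * inner ℝ (S.policyGrad K) (S.policyGrad K + e) +
        L * η ^ 2 * ‖S.policyGrad K + e‖ ^ 2 := by
  have h_small := hS.step_small hK hJ hζ hη hL hLη he
  have h_model := (abs_le.1 (hS.abs_cost_add_sub_inner_le hK hJ hζ h_small)).2
  rw [← sub_eq_add_neg, inner_neg_right, inner_smul_right, norm_neg, norm_smul, mul_pow,
    Real.norm_eq_abs, sq_abs] at h_model
  have h_curv : 22 * ψ ^ 2 * σw ^ 2 * ζ ^ 7 * (η ^ 2 * ‖S.policyGrad K + e‖ ^ 2) ≤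
      L * (η ^ 2 * ‖S.policyGrad K + e‖ ^ 2) := by gcongr
  linarith

theorem step_mem_feasible (hS : S.Bounded β₀ σw ψ) (hζ : 1 ≤ ζ)
    (hopt : S.optCost ≤ β₀ * σw ^ 2 * ζ ^ 2 / 4) (hμ₀ : 0 ≤ μ)
    (hμ : μ * ζ ^ 2 ≤ 2 * β₀ * σw ^ 2) (hη : 0 ≤ η) (hμη : μ * η ≤ 1)
    (hL : 22 * ψ ^ 2 * σw ^ 2 * ζ ^ 7 ≤ L) (hLη : 2 * L * η ≤ 1)
    (hK : K ∈ S.feasible (β₀ * σw ^ 2 * ζ ^ 2))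
    (he : ‖e‖ ^ 2 ≤ μ * (β₀ * σw ^ 2 * ζ ^ 2) / 2) :
    K - η • (S.policyGrad K + e) ∈ S.feasible (β₀ * σw ^ 2 * ζ ^ 2) := by
  obtain ⟨hKs, hKJ⟩ := hK
  have hβ := hS.β₀_pos
  have h_err := hS.norm_error_le hζ hμ he
  set J := β₀ * σw ^ 2 * ζ ^ 2
  refine ⟨?_, ?_⟩
  · rw [sub_eq_add_neg]
    exact hS.stabilizing_add hKs hKJ hζ (hS.step_small hKs hKJ hζ hη hL hLη h_err)
  · have hJ₀ : 0 ≤ J := by positivity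
    have h_dom := hS.mul_cost_sub_optCost_le hKs (hopt.trans (by linarith)) hμ₀ hμ
    have h_shrink : (1 - μ * η) * (S.cost K) ≤ (1 - μ * η) * J := by
      have := sub_nonneg.2 hμη
      gcongr
    calc S.cost (K - η • (S.policyGrad K + e))
        ≤ S.cost K - η / 2 * ‖S.policyGrad K‖ ^ 2 + η / 2 * ‖e‖ ^ 2 :=
          inexact_step_le hη hLη (hS.cost_step_le hKs hKJ hζ hη hL hLη h_err)
      _ ≤ S.cost K - η / 2 * (2 * μ * (S.cost K - S.optCost)) + η / 2 * (μ * J / 2) := by gcongr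
      _ = (1 - μ * η) * S.cost K + μ * η * S.optCost + μ * η * J / 4 := by ring
      _ ≤ (1 - μ * η) * J + μ * η * (J / 4) + μ * η * J / 4 := by gcongr
      _ ≤ J := by linarith [show 0 ≤ μ * η * J by positivity]

theorem isDescentRegion_feasible (hS : S.Bounded β₀ σw ψ) (hζ : 1 ≤ ζ)
    (hopt : S.optCost ≤ β₀ * σw ^ 2 * ζ ^ 2 / 4) (hμ₀ : 0 ≤ μ)
    (hμ : μ * ζ ^ 2 ≤ 2 * β₀ * σw ^ 2) (hη : 0 ≤ η) (hμη : μ * η ≤ 1)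
    (hL : 22 * ψ ^ 2 * σw ^ 2 * ζ ^ 7 ≤ L) (hLη : 2 * L * η ≤ 1) :
    IsDescentRegion S.cost (S.feasible (β₀ * σw ^ 2 * ζ ^ 2)) S.optCost μ L η
      (μ * (β₀ * σw ^ 2 * ζ ^ 2) / 2) where
  differentiableAt K hK := (hS.hasGradientAt_cost hK.1 hK.2 hζ).differentiableAt
  abs_bdd := ⟨β₀ * σw ^ 2 * ζ ^ 2, fun K hK => by
    rw [abs_of_nonneg (hS.cost_nonneg hK.1)]
    exact hK.2⟩
  gradient_bdd := ⟨3 * ψ * σw ^ 2 * ζ ^ 4, fun K hK => by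
    rw [hS.gradient_cost hK.1 hK.2 hζ]
    exact hS.norm_policyGrad_le hK.1 hK.2 hζ⟩
  gradient_dominated K hK := by
    have hβ := hS.β₀_pos
    have hJ₀ : 0 ≤ β₀ * σw ^ 2 * ζ ^ 2 := by positivity
    rw [hS.gradient_cost hK.1 hK.2 hζ]
    exact hS.mul_cost_sub_optCost_le hK.1 (hopt.trans (by linarith)) hμ₀ hμ
  step_mem K hK e he := by
    rw [hS.gradient_cost hK.1 hK.2 hζ]
    exact hS.step_mem_feasible hζ hopt hμ₀ hμ hη hμη hL hLη hK he
  step_le K hK e he := by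
    rw [hS.gradient_cost hK.1 hK.2 hζ]
    exact hS.cost_step_le hK.1 hK.2 hζ hη hL hLη (hS.norm_error_le hζ hμ he)

end GradientStep

end Bounded

end LQR

section CtGDescent

variable {μ η lbSq pSq : ℝ}

theorem gam_pos (h : μ * η < 1) : 0 < gam μ η := Real.sqrt_pos.2 (sub_pos.2 h)

theorem gam_lt_one (h : 0 < μ * η) : gam μ η < 1 := by
  rw [gam, Real.sqrt_lt' one_pos]
  linarith

theorem gam_sq (h : μ * η ≤ 1) : gam μ η ^ 2 = 1 - μ * η := Real.sq_sqrt (sub_nonneg.2 h)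

theorem norm_div_ctg_smul_sq_le {E : Type*} [NormedAddCommGroup E] [NormedSpace ℝ E]
    {T : ℕ} {G Δ ε : ℝ} {N : E} (hT : 1 ≤ T) (hμη₀ : 0 < μ * η) (hμη : μ * η < 1) (hp : 0 < pSq)
    (hle : lbSq ≤ pSq) (hlb : 0 ≤ lbSq) (hε₀ : 0 ≤ ε) (hε : G ^ 2 * Δ ^ 2 ≤ ε * lbSq)
    (hN : ‖N‖ ≤ Δ) (t : ℕ) : ‖(G / ctg T pSq μ η lbSq t) • N‖ ^ 2 ≤ ε := by
  have hγ := gam_pos hμη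
  have hγ₁ := gam_lt_one hμη₀
  rw [norm_smul, mul_pow, Real.norm_eq_abs, sq_abs, div_pow, ctg_sq hT hγ hγ₁ hp hle hlb,
    div_mul_eq_mul_div, div_le_iff₀ (ctgPowerSq_pos hT hγ hγ₁ hp hle hlb t)]
  calc G ^ 2 * ‖N‖ ^ 2 ≤ G ^ 2 * Δ ^ 2 := by gcongr
    _ ≤ ε * lbSq := hε
    _ ≤ ε * ctgPowerSq T pSq μ η lbSq t := by
        gcongr
        exact le_ctgPowerSq hT hγ hγ₁ hp hle t

theorem sum_pow_mul_div_ctg_sq {T : ℕ} (hT : 1 ≤ T) (hμη₀ : 0 < μ * η) (hμη : μ * η < 1)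
    (hp : 0 < pSq) (hle : lbSq ≤ pSq) (hlb : 0 ≤ lbSq) (L G v : ℝ) :
    ∑ t ∈ Finset.range T,
        (1 - μ * η) ^ (T - t - 1) * (L * η ^ 2 * (G / ctg T pSq μ η lbSq t) ^ 2 * v) =
      L * G ^ 2 * η ^ 2 * v *
        ((∑ t ∈ Finset.range (ctgSwitch T pSq μ η lbSq), gam μ η ^ (2 * (T - t - 1))) / lbSq +
          (∑ t ∈ Finset.Ico (ctgSwitch T pSq μ η lbSq) T, gam μ η ^ (T - t - 1)) ^ 2 /
            (T * pSq - ctgSwitch T pSq μ η lbSq * lbSq)) := by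
  have hγ := gam_pos hμη
  have hγ₁ := gam_lt_one hμη₀
  rw [← sum_gam_pow_div_ctgPowerSq hT hγ hγ₁ hp hle, Finset.mul_sum]
  refine Finset.sum_congr rfl fun t _ => ?_
  rw [div_pow, ctg_sq hT hγ hγ₁ hp hle hlb, pow_mul, gam_sq hμη.le]
  ring

theorem IsDescentRegion.ctg_convergence {E : Type*} [NormedAddCommGroup E] [InnerProductSpace ℝ E]
    [CompleteSpace E] [MeasurableSpace E] [BorelSpace E] [SecondCountableTopology E] {Ω : Type*}
    [MeasurableSpace Ω] {P : Measure Ω} [IsProbabilityMeasure P] {f : E → ℝ} {F : Set E}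
    {G L ε fopt v Δ : ℝ} {x₀ : E} {T : ℕ} {ν : ℕ → Ω → E}
    (hF : IsDescentRegion f F fopt μ L η ε) (hη : 0 ≤ η) (hLη : 2 * L * η ≤ 1)
    (hμη₀ : 0 < μ * η) (hμη : μ * η < 1) (hG : G ≠ 0) (hT : 1 ≤ T) (hp : 0 < pSq)
    (hle : lbSq ≤ pSq) (hlb : 0 ≤ lbSq) (hε₀ : 0 ≤ ε) (hε : G ^ 2 * Δ ^ 2 ≤ ε * lbSq)
    (hx₀ : x₀ ∈ F) (hν : IsBoundedNoise ν P T Δ v) :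
    (∀ᵐ ω ∂P, ∀ t ≤ T, pagd f G η (ctg T pSq μ η lbSq) x₀ (fun i => ν i ω) t ∈ F) ∧
    Integrable (fun ω => f (pagd f G η (ctg T pSq μ η lbSq) x₀ (fun i => ν i ω) T)) P ∧
    ∫ ω, (f (pagd f G η (ctg T pSq μ η lbSq) x₀ (fun i => ν i ω) T) - fopt) ∂P ≤
      (1 - μ * η) ^ T * (f x₀ - fopt) +
        L * G ^ 2 * η ^ 2 * v *
          ((∑ t ∈ Finset.range (ctgSwitch T pSq μ η lbSq), gam μ η ^ (2 * (T - t - 1))) / lbSq +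
            (∑ t ∈ Finset.Ico (ctgSwitch T pSq μ η lbSq) T, gam μ η ^ (T - t - 1)) ^ 2 /
              (T * pSq - ctgSwitch T pSq μ η lbSq * lbSq)) := by
  have h_ne : ∀ t < T, ctg T pSq μ η lbSq t ≠ 0 := fun t _ =>
    (Real.sqrt_pos.2
      (ctgPowerSq_pos hT (gam_pos hμη) (gam_lt_one hμη₀) hp hle hlb t)).ne'
  have h_err : ∀ t < T, ∀ᵐ ω ∂P, ‖(G / ctg T pSq μ η lbSq t) • ν t ω‖ ^ 2 ≤ ε := fun t ht =>
    (hν.norm_le t ht).mono fun ω hω =>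
      norm_div_ctg_smul_sq_le hT hμη₀ hμη hp hle hlb hε₀ hε hω t
  rw [← sum_pow_mul_div_ctg_sq hT hμη₀ hμη hp hle hlb]
  exact ⟨hF.ae_pagd_mem hG h_ne hx₀ h_err,
    hF.integrable_pagd hG h_ne hx₀ hν.measurable h_err le_rfl,
    hF.integral_pagd_sub_le hη hLη hμη.le hG h_ne hx₀ hν h_err⟩

end CtGDescent

namespace LQR

variable {n m : ℕ} {S : LQR n m} {β₀ β₁ σw ψ J : ℝ} {K : Gain m n}

theorem bounded_of_posSemidef (hn : n ≠ 0) (hβ₀ : 0 < β₀) (hβ₁ : β₁ ≤ 1) (hσw : 0 < σw)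
    (hψ : 1 ≤ ψ) (hR₀ : (S.R - β₀ • (1 : Matrix (Fin m) (Fin m) ℝ)).PosSemidef)
    (hR₁ : (β₁ • (1 : Matrix (Fin m) (Fin m) ℝ) - S.R).PosSemidef)
    (hQ₀ : (S.Q - β₀ • (1 : Matrix (Fin n) (Fin n) ℝ)).PosSemidef)
    (hQ₁ : (β₁ • (1 : Matrix (Fin n) (Fin n) ℝ) - S.Q).PosSemidef)
    (hW : (S.W - σw ^ 2 • (1 : Matrix (Fin n) (Fin n) ℝ)).PosSemidef)
    (hB : spectralNorm S.B ≤ ψ) : S.Bounded β₀ σw ψ where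
  β₀_pos := hβ₀
  β₀_le_one := by
    have h_diag := PosSemidef.diag_nonneg ((le_iff.2 hQ₀).trans (le_iff.2 hQ₁))
      (i := ⟨0, Nat.pos_of_ne_zero hn⟩)
    simp only [Matrix.sub_apply, Matrix.smul_apply, one_apply_eq, smul_eq_mul, mul_one] at h_diag
    linarith
  σw_pos := hσw
  one_le_ψ := hψ
  smul_one_le_Q := le_iff.2 hQ₀
  smul_one_le_R := le_iff.2 hR₀
  R_le_one := (Matrix.le_iff.2 hR₁).trans
    (smul_le_of_le_one_left zero_le_one hβ₁)
  smul_one_le_W := le_iff.2 hW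
  spectralNorm_B_le := hB

theorem Bounded.one_le_sqrt_div (hS : S.Bounded β₀ σw ψ) (hn : n ≠ 0) (hK : S.Stabilizing K)
    (hopt : S.optCost ≤ J) : 1 ≤ √(J / (β₀ * σw ^ 2)) := by
  have hβσ : 0 < β₀ * σw ^ 2 := mul_pos hS.β₀_pos hS.sq_σw_pos
  have hn₁ : (1 : ℝ) ≤ n := by exact_mod_cast Nat.one_le_iff_ne_zero.2 hn
  rw [Real.one_le_sqrt, one_le_div hβσ]
  calc β₀ * σw ^ 2 ≤ β₀ * σw ^ 2 * n := le_mul_of_one_le_right hβσ.le hn₁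
    _ ≤ S.optCost := hS.dimension_le_optCost hK
    _ ≤ J := hopt

theorem Bounded.eq_mul_sq_sqrt_div (hS : S.Bounded β₀ σw ψ) (hJ : 0 ≤ J) :
    J = β₀ * σw ^ 2 * √(J / (β₀ * σw ^ 2)) ^ 2 := by
  have hβσ : 0 < β₀ * σw ^ 2 := mul_pos hS.β₀_pos hS.sq_σw_pos
  rw [Real.sq_sqrt (by positivity), mul_div_cancel₀ _ hβσ.ne']

theorem Bounded.mul_pow_seven_le {ζ : ℝ} (hS : S.Bounded β₀ σw ψ) (hn : n ≠ 0) (hζ : 1 ≤ ζ) :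
    22 * ψ ^ 2 * σw ^ 2 * ζ ^ 7 ≤ 112 * √n * (β₀ * σw ^ 2 * ζ ^ 2) * ψ ^ 2 * ζ ^ 8 / β₀ := by
  have hβ := hS.β₀_pos
  have hn₁ : 1 ≤ √(n : ℝ) := Real.one_le_sqrt.2 (by exact_mod_cast Nat.one_le_iff_ne_zero.2 hn)
  calc 22 * ψ ^ 2 * σw ^ 2 * ζ ^ 7 = 22 * 1 * ψ ^ 2 * σw ^ 2 * ζ ^ 7 := by ring
    _ ≤ 112 * √n * ψ ^ 2 * σw ^ 2 * ζ ^ 10 := by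
        gcongr
        · norm_num
        · norm_num
    _ = 112 * √n * (β₀ * σw ^ 2 * ζ ^ 2) * ψ ^ 2 * ζ ^ 8 / β₀ := by field_simp

theorem Bounded.mul_stepSize_lt_one {ζ μ L η : ℝ} (hS : S.Bounded β₀ σw ψ) (hζ : 1 ≤ ζ)
    (hμ₀ : 0 ≤ μ) (hμ : μ * ζ ^ 2 ≤ 2 * β₀ * σw ^ 2) (hη : 0 ≤ η)
    (hL : 22 * ψ ^ 2 * σw ^ 2 * ζ ^ 7 ≤ L) (hLη : 2 * L * η ≤ 1) : μ * η < 1 := by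
  have hβ := hS.β₀_pos
  have hψ := hS.one_le_ψ
  have hμL : μ ≤ L := by
    calc μ ≤ μ * ζ ^ 2 := le_mul_of_one_le_right hμ₀ (one_le_pow₀ hζ)
      _ ≤ 2 * β₀ * σw ^ 2 := hμ
      _ ≤ 22 * 1 * σw ^ 2 := by
          gcongr
          · norm_num
          · exact hS.β₀_le_one
      _ ≤ 22 * (ψ ^ 2 * ζ ^ 7) * σw ^ 2 := by
          gcongr
          exact one_le_mul_of_one_le_of_one_le (one_le_pow₀ hψ) (one_le_pow₀ hζ)
      _ = 22 * ψ ^ 2 * σw ^ 2 * ζ ^ 7 := by ring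
      _ ≤ L := hL
  have : μ * η ≤ L * η := by gcongr
  linarith

end LQR

end LQRPower

theorem mainTheorem3_general {n m : ℕ} (hn : n ≠ 0) {S : LQRPower.LQR n m}
    {β₀ σw ψ Jbar ζ μ L G : ℝ} (hS : S.Bounded β₀ σw ψ) (hopt : S.optCost ≤ Jbar / 4)
    (hζ : ζ = √(Jbar / (β₀ * σw ^ 2))) (hμ₀ : 0 < μ) (hμ : μ ≤ 2 * Jbar / ζ ^ 4)
    (hL : 22 * ψ ^ 2 * σw ^ 2 * ζ ^ 7 ≤ L) (hG : G ≠ 0)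
    {T : ℕ} (hT : 1 ≤ T) {η : ℝ} (hη₀ : 0 < η) (hLη : 2 * L * η ≤ 1)
    {K₀ : LQRPower.Gain m n} (hK₀ : K₀ ∈ S.feasible Jbar)
    {Ω : Type*} [MeasurableSpace Ω] {P : Measure Ω} [IsProbabilityMeasure P]
    {ν : ℕ → Ω → LQRPower.Gain m n} {Δ v : ℝ} (hν : LQRPower.IsBoundedNoise ν P T Δ v)
    {lbSq pSq : ℝ} (hlb : G ^ 2 * Δ ^ 2 * (2 / (μ * Jbar)) ≤ lbSq) (hp : 0 < pSq)
    (hle : lbSq ≤ pSq) {ts : ℕ} (hts : ts = LQRPower.ctgSwitch T pSq μ η lbSq)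
    {K : ℕ → Ω → LQRPower.Gain m n}
    (hK : ∀ t ω, K t ω =
      LQRPower.pagd S.cost G η (LQRPower.ctg T pSq μ η lbSq) K₀ (fun s => ν s ω) t) :
    (∀ᵐ ω ∂P, ∀ t ≤ T, K t ω ∈ S.feasible Jbar) ∧
    Integrable (fun ω => S.cost (K T ω)) P ∧
    ∫ ω, (S.cost (K T ω) - S.optCost) ∂P ≤
      (1 - μ * η) ^ T * (S.cost K₀ - S.optCost) +
        L * G ^ 2 * η ^ 2 * v *
          ((∑ t ∈ Finset.range ts, LQRPower.gam μ η ^ (2 * (T - t - 1))) / lbSq +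
            (∑ t ∈ Finset.Ico ts T, LQRPower.gam μ η ^ (T - t - 1)) ^ 2 /
              (T * pSq - ts * lbSq)) := by
  have hβσ : 0 < β₀ * σw ^ 2 := mul_pos hS.β₀_pos hS.sq_σw_pos
  have hJ₀ : 0 ≤ Jbar := (hS.cost_nonneg hK₀.1).trans hK₀.2
  have hζ₁ : 1 ≤ ζ := hζ ▸ hS.one_le_sqrt_div hn hK₀.1 (hopt.trans (by linarith))
  obtain rfl : Jbar = β₀ * σw ^ 2 * ζ ^ 2 := hζ ▸ hS.eq_mul_sq_sqrt_div hJ₀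
  have hμ' : μ * ζ ^ 2 ≤ 2 * β₀ * σw ^ 2 := by
    have hζ₀ : ζ ≠ 0 := by positivity
    calc μ * ζ ^ 2 ≤ 2 * (β₀ * σw ^ 2 * ζ ^ 2) / ζ ^ 4 * ζ ^ 2 := by gcongr
      _ = 2 * β₀ * σw ^ 2 := by field_simp
  have hμη := hS.mul_stepSize_lt_one hζ₁ hμ₀.le hμ' hη₀.le hL hLη
  have hlb₀ : 0 ≤ lbSq := le_trans (by positivity) hlb
  have hε : G ^ 2 * Δ ^ 2 ≤ μ * (β₀ * σw ^ 2 * ζ ^ 2) / 2 * lbSq := by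
    rwa [← div_le_iff₀' (by positivity), div_eq_mul_inv, inv_div]
  simp only [hK, hts]
  exact (hS.isDescentRegion_feasible hζ₁ hopt hμ₀.le hμ' hη₀.le hμη.le hL hLη).ctg_convergence
    hη₀.le hLη (by positivity) hμη hG hT hp hle hlb₀ (by positivity) hε hK₀ hν

theorem mainTheorem3 {n m : ℕ} (S : LQRPower.LQR n m)
    -- bounds on the problem data
    (β₀ β₁ σw ψ Jbar : ℝ) (hβ₀ : 0 < β₀) (hβ₁ : β₁ ≤ 1) (hσw : 0 < σw) (hψ : 1 ≤ ψ)
    (hJbar : 0 < Jbar)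
    (hR₀ : (S.R - β₀ • (1 : Matrix (Fin m) (Fin m) ℝ)).PosSemidef)
    (hR₁ : (β₁ • (1 : Matrix (Fin m) (Fin m) ℝ) - S.R).PosSemidef)
    (hQ₀ : (S.Q - β₀ • (1 : Matrix (Fin n) (Fin n) ℝ)).PosSemidef)
    (hQ₁ : (β₁ • (1 : Matrix (Fin n) (Fin n) ℝ) - S.Q).PosSemidef)
    (hW : (S.W - σw ^ 2 • (1 : Matrix (Fin n) (Fin n) ℝ)).PosSemidef)
    (hB : LQRPower.spectralNorm S.B ≤ ψ)
    (hopt : S.optCost ≤ Jbar / 4)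
    -- landscape constants
    (ζ μ L G D : ℝ)
    (hζ : ζ = √(Jbar / (β₀ * σw ^ 2)))
    (hμ : μ = 2 * Jbar / ζ ^ 4)
    (hL : L = 112 * √(n : ℝ) * Jbar * ψ ^ 2 * ζ ^ 8 / β₀)
    (hG : G = 2 * Jbar / (β₀ * σw ^ 2) * √((σw ^ 2 + ψ ^ 2 * Jbar) * Jbar))
    (hD : D = 1 / (ψ * ζ ^ 3))
    -- horizon, step size, initial gain
    (T : ℕ) (hT : 1 ≤ T) (η : ℝ) (hη₀ : 0 < η) (hη : η < min (D / G) (1 / (4 * L)))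
    (K₀ : LQRPower.Gain m n) (hK₀ : K₀ ∈ S.feasible Jbar)
    -- channel noise
    {Ω : Type*} [MeasurableSpace Ω] (P : MeasureTheory.Measure Ω)
    [MeasureTheory.IsProbabilityMeasure P]
    (ν : ℕ → Ω → LQRPower.Gain m n) (hν : ∀ t, Measurable (ν t))
    (hindep : ProbabilityTheory.iIndepFun ν P)
    (hmean : ∀ t, ∫ ω, ν t ω ∂P = 0)
    (σN : ℝ) (hvar : ∀ t, ∫ ω, ‖ν t ω‖ ^ 2 ∂P = σN ^ 2)
    (Δ : ℝ) (hΔ : ∀ t < T, ∀ᵐ ω ∂P, ‖ν t ω‖ ≤ Δ)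
    -- power lower bound and power budget
    (lbSq : ℝ) (hlb : lbSq = G ^ 2 * Δ ^ 2 * max (η ^ 2 / (D - G * η) ^ 2) (2 / (μ * Jbar)))
    (σp : ℝ) (hσp : 0 < σp) (hbudget : lbSq ≤ σp ^ 2)
    -- switching time and iterates
    (ts : ℕ) (hts : ts = LQRPower.ctgSwitch T (σp ^ 2) μ η lbSq)
    (K : ℕ → Ω → LQRPower.Gain m n)
    (hK : ∀ t ω, K t ω =
      LQRPower.pagd S.cost G η (LQRPower.ctg T (σp ^ 2) μ η lbSq) K₀ (fun s => ν s ω) t) :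
    (∀ᵐ ω ∂P, ∀ t ≤ T, K t ω ∈ S.feasible Jbar) ∧
    MeasureTheory.Integrable (fun ω => S.cost (K T ω)) P ∧
    ∫ ω, (S.cost (K T ω) - S.optCost) ∂P ≤
      (1 - μ * η) ^ T * (S.cost K₀ - S.optCost) +
        L * G ^ 2 * η ^ 2 * σN ^ 2 *
          ((∑ t ∈ Finset.range ts, LQRPower.gam μ η ^ (2 * (T - t - 1))) / lbSq +
            (∑ t ∈ Finset.Ico ts T, LQRPower.gam μ η ^ (T - t - 1)) ^ 2 /
              (T * σp ^ 2 - ts * lbSq)) := by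
  have hn : n ≠ 0 := by
    rintro rfl
    have : η < 1 / (4 * L) := lt_min_iff.1 hη |>.2
    simp only [hL, CharP.cast_eq_zero, Real.sqrt_zero, mul_zero, zero_mul, zero_div,
      div_zero] at this
    exact this.not_gt hη₀
  have hS := LQRPower.LQR.bounded_of_posSemidef hn hβ₀ hβ₁ hσw hψ hR₀ hR₁ hQ₀ hQ₁ hW hB
  have hζ₁ : 1 ≤ ζ := hζ ▸ hS.one_le_sqrt_div hn hK₀.1 (hopt.trans (by linarith))
  have hL' : 22 * ψ ^ 2 * σw ^ 2 * ζ ^ 7 ≤ L := by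
    have hJ : Jbar = β₀ * σw ^ 2 * ζ ^ 2 := hζ ▸ hS.eq_mul_sq_sqrt_div hJbar.le
    exact hL ▸ hJ ▸ hS.mul_pow_seven_le hn hζ₁
  have hLη : 2 * L * η ≤ 1 := by
    have hL₀ : 0 < L := lt_of_lt_of_le (by positivity) hL'
    have := (lt_div_iff₀ (by positivity)).1 (lt_min_iff.1 hη).2
    linarith
  exact mainTheorem3_general hn hS hopt hζ (hμ ▸ by positivity) hμ.le hL' (hG ▸ by positivity) hT
    hη₀ hLη hK₀ ⟨hν, hindep, fun t _ => hmean t, fun t _ => hvar t, hΔ⟩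
    (hlb ▸ by gcongr; exact le_max_right _ _) (by positivity) hbudget hts hK
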